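/- Let $G$ be a simple graph on the vertex set $\{1,\dots,n\}$ that is chordal, i.e. its vertices can be ordered so that for each vertex $v$ the subgraph induced on $v$ and those of its neighbours that occur before it is complete. Assume that exactly one connected component of $G$ contains an edge (for example, $G$ is connected and $n\ge 2$). Identify $\mathbb{C}^{2n}$ with the space of complex $2\times n$ matrices $$\begin{pmatrix} x_1 & \cdots & x_n\\ y_1 & \cdots & y_n\end{pmatrix},$$ and let $\mathcal{A}_G$ be the determinantal arrangement consisting of the hypersurfaces $\{x_iy_j-x_jy_i=0\}$, one for each edge $\{i,j\}$ of $G$ with $i<j$. Let $U=\mathbb{C}^{2n}\setminus\bigcup_{V\in\mathcal{A}_G}V$. Then, for every $i\ge 2$ and all choices of base points, there is an isomorphism of groups $\pi_i(U)\cong\pi_i(S^3)$. -/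

import Mathlib

open scoped Topology

namespace DetArrangement

/-- A graph on `n` vertices is chordal if its vertices can be ordered (`σ v` is the position of `v`)
so that for each `v`, the subgraph induced on `v` and those of its neighbours that occur before it
is complete. -/
def IsChordal {n : ℕ} (G : SimpleGraph (Fin n)) : Prop :=
  ∃ σ : Equiv.Perm (Fin n), ∀ v : Fin n,
    G.IsClique (insert v {w : Fin n | G.Adj v w ∧ σ w < σ v})

/-- The `2`-minor `Δ_ij = x_i y_j - x_j y_i` of a `2 × n` matrix with rows `x` and `y`. -/
def minor {n : ℕ} (i j : Fin n) (M : Matrix (Fin 2) (Fin n) ℂ) : ℂ :=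
  M 0 i * M 1 j - M 0 j * M 1 i

/-- The determinantal variety `Var(Δ_ij)` in the space `ℂ^{2n}` of `2 × n` matrices. -/
def detVariety {n : ℕ} (i j : Fin n) : Set (Matrix (Fin 2) (Fin n) ℂ) :=
  {M | minor i j M = 0}

/-- The determinantal arrangement of `G`: the varieties `Var(Δ_ij)`, one for each edge of `G`. -/
def arrangement {n : ℕ} (G : SimpleGraph (Fin n)) : Set (Set (Matrix (Fin 2) (Fin n) ℂ)) :=
  {V | ∃ i j : Fin n, i < j ∧ G.Adj i j ∧ V = detVariety i j}

/-- The complement in `ℂ^{2n}` of the union of the determinantal arrangement of `G`. -/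
def complement {n : ℕ} (G : SimpleGraph (Fin n)) : Set (Matrix (Fin 2) (Fin n) ℂ) :=
  (⋃₀ arrangement G)ᶜ

/-- Exactly one connected component of `G` contains an edge, that is, has at least two vertices.
Every connected graph with at least two vertices satisfies this. -/
def HasUniqueNontrivialComponent {n : ℕ} (G : SimpleGraph (Fin n)) : Prop :=
  ∃! c : G.ConnectedComponent, c.supp.Nontrivial

end DetArrangement

/-! ### Generalized loops and their homotopies -/

open scoped unitInterval Topology.Homotopy

/-! Let a be the first non-isolated vertex in the elimination order. On U its column is a nonzero
vector of ℂ², that is, a point of S³ and a positive length. The point of S³ is the first column of a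
unique matrix in SU(2), and left multiplication by matrices of determinant 1 preserves every minor.
Hence U ≅ S³ × F, where F is the `slice` on which column a is a positive multiple of the first basis
vector (`exists_sphere_splitting`). It remains to see that F has no homotopy in degrees at least 2
(`loopsContract_slice`).

The edge conditions on F are imposed vertex by vertex. The condition at v says that column v avoids
the lines spanned by the columns of the earlier neighbours of v. These neighbours form a clique, so
the lines are pairwise distinct. They are genuine lines because, with a single nontrivial component,
every non-isolated vertex other than a has an earlier neighbour (`exists_first_vertex`). The new
fibre is thus ℂ² minus r ≥ 1 lines, which is ℂ* × (ℂ minus r - 1 points)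
(`LoopsContract.complement_lines`); lifting homotopies past moving punctures
(`exists_avoiding_lift`) carries the vanishing up the tower.

The planar input is `loopsContract_punctured`. A homeomorphism of the plane makes the punctures
real. Copies of the two half-planes, glued across the gaps in the pattern of a tree, then give a
covering whose projection contracts along the tree to a locally constant map, and
`IsCoveringMap.loopsContract` applies. -/

/-- Every `N`-dimensional generalized loop in `X`, at any base point, is null-homotopic relative to
the boundary of the cube. -/
def LoopsContract (N X : Type*) [TopologicalSpace X] : Prop :=
  ∀ (x : X) (f : Ω^ N X x), GenLoop.Homotopic f GenLoop.const

namespace GenLoop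

variable {N X Y : Type*} [TopologicalSpace X] [TopologicalSpace Y] {x : X}

theorem homotopic_of_continuous {f g : Ω^ N X x} (H : I × (I^N) → X) (hc : Continuous H)
    (h0 : ∀ y, H (0, y) = f y) (h1 : ∀ y, H (1, y) = g y)
    (hb : ∀ t, ∀ y ∈ Cube.boundary N, H (t, y) = x) : Homotopic f g :=
  ⟨⟨⟨⟨H, hc⟩, h0, h1⟩, fun t y hy => (hb t y hy).trans (GenLoop.boundary f y hy).symm⟩⟩

theorem Homotopic.exists_continuous {f g : Ω^ N X x} (h : Homotopic f g) :
    ∃ H : I × (I^N) → X, Continuous H ∧ (∀ y, H (0, y) = f y) ∧ (∀ y, H (1, y) = g y) ∧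
      ∀ t, ∀ y ∈ Cube.boundary N, H (t, y) = x := by
  obtain ⟨H⟩ := h
  exact ⟨H, H.continuous, H.apply_zero, H.apply_one,
    fun t y hy => (H.eq_fst t hy).trans (GenLoop.boundary f y hy)⟩

/-- The image of a generalized loop under a continuous map. -/
def map (φ : C(X, Y)) (f : Ω^ N X x) : Ω^ N Y (φ x) :=
  ⟨φ.comp f.1, fun y hy => congrArg φ (f.2 y hy)⟩

@[simp]
theorem map_apply (φ : C(X, Y)) (f : Ω^ N X x) (t : I^N) : map φ f t = φ (f t) := rfl

theorem Homotopic.map {f g : Ω^ N X x} (h : Homotopic f g) (φ : C(X, Y)) :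
    Homotopic (GenLoop.map φ f) (GenLoop.map φ g) := by
  obtain ⟨H, hc, h0, h1, hb⟩ := h.exists_continuous
  exact homotopic_of_continuous (fun p => φ (H p)) (φ.continuous.comp hc)
    (fun y => congrArg φ (h0 y)) (fun y => congrArg φ (h1 y)) fun t y hy => congrArg φ (hb t y hy)

end GenLoop

/-! ### From free to based null-homotopies -/

section Collar

/-- The self-map of the unit interval stretching the middle half onto the whole interval. -/
noncomputable def stretch (a : I) : I := Set.projIcc 0 1 zero_le_one (2 * (a : ℝ) - 1 / 2)

/-- A function on the unit interval that vanishes exactly at the end points and is `1` on the middle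
half. -/
noncomputable def plateau (a : I) : I :=
  Set.projIcc 0 1 zero_le_one (4 * min (a : ℝ) (1 - a))

theorem continuous_stretch : Continuous stretch :=
  continuous_projIcc.comp (by fun_prop)

theorem continuous_plateau : Continuous plateau :=
  continuous_projIcc.comp (by fun_prop)

theorem stretch_zero : stretch 0 = 0 :=
  Set.projIcc_of_le_left _ (by norm_num)

theorem stretch_one : stretch 1 = 1 :=
  Set.projIcc_of_right_le _ (by norm_num)

theorem plateau_zero : plateau 0 = 0 :=
  Set.projIcc_of_le_left _ (by norm_num)

theorem plateau_one : plateau 1 = 0 :=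
  Set.projIcc_of_le_left _ (by norm_num)

theorem plateau_eq_one_or (a : I) : plateau a = 1 ∨ stretch a = 0 ∨ stretch a = 1 := by
  rcases le_total (a : ℝ) (1 / 4) with h | h
  · exact Or.inr (Or.inl (Set.projIcc_of_le_left _ (by linarith)))
  rcases le_total (3 / 4) (a : ℝ) with h' | h'
  · exact Or.inr (Or.inr (Set.projIcc_of_right_le _ (by linarith)))
  · refine Or.inl (Set.projIcc_of_right_le _ ?_)
    have : 1 / 4 ≤ min (a : ℝ) (1 - a) := le_min h (by linarith)
    linarith

/-- Interpolation between two points of the unit interval. -/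
noncomputable def interp (t a b : I) : I :=
  ⟨(1 - t) * a + t * b, by
    have := t.2.1; have := t.2.2; have := a.2.1; have := a.2.2; have := b.2.1; have := b.2.2
    constructor <;> nlinarith⟩

theorem Continuous.interp {Z : Type*} [TopologicalSpace Z] {f g h : Z → I} (hf : Continuous f)
    (hg : Continuous g) (hh : Continuous h) : Continuous fun z => interp (f z) (g z) (h z) :=
  Continuous.subtype_mk (by fun_prop) _

variable {N X : Type*} [Fintype N] [TopologicalSpace X] {x : X}

/-- The free homotopy moves the base point along a path. Squeeze `f` into the middle of the cube and
let the collar trace that path: after `e₂` every point lies either where `H` has reached time 1 or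
where `stretch` lands in the boundary, so the map depends only on the product of plateaus and
retracts along the path. -/
theorem GenLoop.homotopic_const_of_free [Nonempty N] (f : Ω^ N X x) (H : I × (I^N) → X)
    (hc : Continuous H) (h0 : ∀ y, H (0, y) = f y)
    (h1 : ∀ y y', H (1, y) = H (1, y'))
    (hb : ∀ t, ∀ y ∈ Cube.boundary N, ∀ y' ∈ Cube.boundary N, H (t, y) = H (t, y')) :
    Homotopic f const := by
  obtain ⟨i₀⟩ := ‹Nonempty N›
  have hz : (0 : I^N) ∈ Cube.boundary N := ⟨i₀, Or.inl rfl⟩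
  have hS : Continuous fun y : I^N => fun i => stretch (y i) :=
    continuous_pi fun i => continuous_stretch.comp (continuous_apply i)
  have hT : Continuous fun y : I^N => ∏ i, plateau (y i) :=
    continuous_finsetProd _ fun i _ => continuous_plateau.comp (continuous_apply i)
  have hbS : ∀ y ∈ Cube.boundary N, (fun i => stretch (y i)) ∈ Cube.boundary N := by
    rintro y ⟨i, hi | hi⟩
    · exact ⟨i, Or.inl (by simp only [hi, stretch_zero])⟩
    · exact ⟨i, Or.inr (by simp only [hi, stretch_one])⟩
  have hbT : ∀ y ∈ Cube.boundary N, ∏ i, plateau (y i) = 0 := by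
    rintro y ⟨i, hi⟩
    refine Finset.prod_eq_zero (Finset.mem_univ i) ?_
    rcases hi with hi | hi <;> rw [hi]
    exacts [plateau_zero, plateau_one]
  have hor : ∀ y : I^N, ∏ i, plateau (y i) = 1 ∨ (fun i => stretch (y i)) ∈ Cube.boundary N := by
    intro y
    by_cases h : ∀ i, plateau (y i) = 1
    · exact Or.inl (Finset.prod_eq_one fun i _ => h i)
    · push Not at h
      obtain ⟨i, hi⟩ := h
      exact Or.inr ⟨i, (plateau_eq_one_or (y i)).resolve_left hi⟩
  have hx : H (0, 0) = x := (h0 0).trans (GenLoop.boundary f 0 hz)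
  let g₁ : Ω^ N X x := ⟨⟨fun y => f fun i => stretch (y i), by
    exact f.1.continuous.comp hS⟩, fun y hy => GenLoop.boundary f _ (hbS y hy)⟩
  let g₂ : Ω^ N X x := ⟨⟨fun y => H (∏ i, plateau (y i), 0), by fun_prop⟩, fun y hy => by
    change H (∏ i, plateau (y i), 0) = x
    rw [hbT y hy, hx]⟩
  have e₁ : Homotopic f g₁ := by
    refine homotopic_of_continuous (fun p => f fun i => interp p.1 (p.2 i) (stretch (p.2 i)))
      (f.1.continuous.comp <| continuous_pi fun i => continuous_fst.interp
        ((continuous_apply i).comp continuous_snd)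
        (continuous_stretch.comp ((continuous_apply i).comp continuous_snd))) ?_ ?_ ?_
    · intro y
      congr 1; ext i; simp [interp]
    · intro y
      change _ = f _
      congr 1; ext i; simp [interp]
    · rintro t y ⟨i, hi | hi⟩ <;> refine GenLoop.boundary f _ ⟨i, ?_⟩ <;> dsimp only <;> rw [hi]
      · left; ext; simp [interp, stretch_zero]
      · right; ext; simp [interp, stretch_one]
  have e₂ : Homotopic g₁ g₂ := by
    refine homotopic_of_continuous (fun p => H (p.1 * ∏ i, plateau (p.2 i),
      fun i => stretch (p.2 i))) (hc.comp ?_) ?_ ?_ ?_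
    · exact (continuous_fst.mul (hT.comp continuous_snd)).prodMk (hS.comp continuous_snd)
    · intro y; simp only [zero_mul, h0]; rfl
    · intro y
      change _ = H (∏ i, plateau (y i), 0)
      rw [one_mul]
      rcases hor y with h | h
      · simp only [h]; exact h1 _ _
      · exact hb _ _ h _ hz
    · intro t y hy
      simp only [hbT y hy, mul_zero, h0]
      exact GenLoop.boundary f _ (hbS y hy)
  have e₃ : Homotopic g₂ const := by
    refine homotopic_of_continuous (fun p => H (σ p.1 * ∏ i, plateau (p.2 i), 0))
      (hc.comp ?_) ?_ ?_ ?_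
    · exact ((unitInterval.continuous_symm.comp continuous_fst).mul
        (hT.comp continuous_snd)).prodMk continuous_const
    · intro y; simp only [unitInterval.symm_zero, one_mul]; rfl
    · intro y; simp only [unitInterval.symm_one, zero_mul, hx]; rfl
    · intro t y hy; simp only [hbT y hy, mul_zero, hx]
  exact e₁.trans (e₂.trans e₃)

end Collar

/-! ### Permanence of vanishing homotopy -/

namespace LoopsContract

variable {N X Y : Type*} [TopologicalSpace X] [TopologicalSpace Y]

theorem of_retract (hX : LoopsContract N X) (s : C(Y, X)) (r : C(X, Y))
    (hrs : ∀ y, r (s y) = y) : LoopsContract N Y := by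
  intro y f
  obtain ⟨H, hc, h0, h1, hb⟩ := (hX _ (GenLoop.map s f)).exists_continuous
  refine GenLoop.homotopic_of_continuous (fun p => r (H p)) (r.continuous.comp hc) ?_ ?_ ?_
  · intro z; rw [h0]; exact hrs _
  · intro z; rw [h1]; exact hrs _
  · intro t z hz; rw [hb t z hz]; exact hrs _

theorem prod (hX : LoopsContract N X) (hY : LoopsContract N Y) : LoopsContract N (X × Y) := by
  rintro ⟨x, y⟩ f
  obtain ⟨H, hc, h0, h1, hb⟩ := (hX _ (GenLoop.map .fst f)).exists_continuous
  obtain ⟨K, kc, k0, k1, kb⟩ := (hY _ (GenLoop.map .snd f)).exists_continuous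
  refine GenLoop.homotopic_of_continuous (fun p => (H p, K p)) (hc.prodMk kc) ?_ ?_ ?_
  · intro z; rw [h0, k0]; rfl
  · intro z; rw [h1, k1]; rfl
  · intro t z hz; rw [hb t z hz, kb t z hz]; rfl

theorem of_convex {V : Type*} [AddCommGroup V] [Module ℝ V] [TopologicalSpace V]
    [IsTopologicalAddGroup V] [ContinuousSMul ℝ V] {s : Set V} (hs : Convex ℝ s) :
    LoopsContract N s := by
  intro x f
  refine GenLoop.homotopic_of_continuous (fun p => ⟨(1 - p.1 : ℝ) • (f p.2 : V) + (p.1 : ℝ) • (x : V),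
    hs (f p.2).2 x.2 (by simpa using p.1.2.2) p.1.2.1 (by ring)⟩) ?_ ?_ ?_ ?_
  · have : Continuous fun p : I × (I^N) => f p.2 := f.1.continuous.comp continuous_snd
    exact Continuous.subtype_mk (by fun_prop) _
  · intro y; ext; simp
  · intro y; ext; simp
  · intro t y hy; ext
    simp only [GenLoop.boundary f y hy]
    rw [← add_smul]; simp

end LoopsContract

/-! ### Covering maps with contractible projection -/

section Covering

variable {N E X : Type*} [TopologicalSpace E] [TopologicalSpace X]

theorem IsCoveringMap.eq_of_segment {p : E → X} (hp : IsCoveringMap p) {A : Type*}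
    [TopologicalSpace A] {g : A → E} (hg : Continuous g) {x : X} (γ : I → A) (hγ : Continuous γ)
    (h : ∀ t, p (g (γ t)) = x) : g (γ 0) = g (γ 1) := by
  have := hp.eq_of_comp_eq (hg.comp hγ) (continuous_const (y := g (γ 0)))
    (funext fun t => (h t).trans (h 0).symm) 0 rfl
  exact (congrFun this 1).symm

/-- The boundary of a cube of dimension at least 2 is path connected: inside the face of direction
`i` shrink the other coordinates to 0, then move the `i`-th one inside the face of direction `j`.
This is where degree 1 is excluded. -/
theorem IsCoveringMap.eq_on_boundary [Nontrivial N] [DecidableEq N] {p : E → X}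
    (hp : IsCoveringMap p) {g : (I^N) → E} (hg : Continuous g) {x : X}
    (h : ∀ y ∈ Cube.boundary N, p (g y) = x) : ∀ y ∈ Cube.boundary N, g y = g 0 := by
  rintro y ⟨i, hi⟩
  obtain ⟨j, hj⟩ := exists_ne i
  have e₁ := hp.eq_of_segment hg (fun t : I => fun k => if k = i then y i else t * y k)
    (continuous_pi fun k => by split_ifs <;> fun_prop) (x := x)
    (fun t => h _ ⟨i, by simpa using hi⟩)
  have e₂ := hp.eq_of_segment hg (fun t : I => fun k => if k = i then t * y i else 0)
    (continuous_pi fun k => by split_ifs <;> fun_prop) (x := x)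
    (fun t => h _ ⟨j, by simp [hj]⟩)
  have a₁ : (fun k => if k = i then y i else 1 * y k) = y := by
    ext k; split_ifs with hk <;> simp [hk]
  have a₂ : (fun k : N => if k = i then 0 * y i else 0) = 0 := by
    ext k; simp
  simp only [zero_mul, one_mul] at e₁ e₂ a₁ a₂
  rw [a₁] at e₁
  rw [a₂] at e₂
  exact e₁.symm.trans e₂.symm

/-- If a covering projection is homotopic to a locally constant map, then the base has vanishing
homotopy groups in all degrees at least two. -/
theorem IsCoveringMap.loopsContract [Fintype N] [Nontrivial N] [DecidableEq N] {p : E → X}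
    (hp : IsCoveringMap p) (hs : Function.Surjective p) (K : I × E → X) (hK : Continuous K)
    (hK0 : ∀ e, K (0, e) = p e) (hK1 : IsLocallyConstant fun e => K (1, e)) :
    LoopsContract N X := by
  intro x f
  obtain ⟨i₀⟩ : Nonempty N := inferInstance
  have hz : (0 : I^N) ∈ Cube.boundary N := ⟨i₀, Or.inl rfl⟩
  obtain ⟨e₀, he₀⟩ := hs x
  -- Shrinking the cube to its corner 0, a boundary point, contracts `f`, so homotopy lifting yields
  -- a lift `g` of `f`.
  let F : C(I × (I^N), X) := ⟨fun q => f fun i => q.1 * q.2 i,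
    f.1.continuous.comp (by fun_prop)⟩
  have hF0 : ∀ y : I^N, F (0, y) = p (ContinuousMap.const _ e₀ y) := fun y => by
    change f (fun i => 0 * y i) = p e₀
    rw [he₀]
    exact GenLoop.boundary f _ ⟨i₀, Or.inl (zero_mul _)⟩
  let G := hp.liftHomotopy F (ContinuousMap.const _ e₀) hF0
  have hG : ∀ q, p (G q) = F q := fun q => congrFun (hp.liftHomotopy_lifts F _ hF0) q
  let g : (I^N) → E := fun y => G (1, y)
  have hg : Continuous g := G.continuous.comp (by fun_prop)
  have hpg : ∀ y, p (g y) = f y := fun y => by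
    rw [hG]
    change f (fun i => 1 * y i) = f y
    simp
  have hbd := hp.eq_on_boundary hg (x := x) fun y hy => (hpg y).trans (GenLoop.boundary f y hy)
  -- Composing `K` with the lift ends at a constant since the cube is connected, and at each time it
  -- is constant on the boundary because `g` is.
  refine GenLoop.homotopic_const_of_free f (fun q => K (q.1, g q.2)) (hK.comp (by fun_prop))
    (fun y => (hK0 _).trans (hpg y)) (fun y y' => ?_) fun t y hy y' hy' => ?_
  · exact (hK1.comp_continuous hg).apply_eq_of_isPreconnected isPreconnected_univ
      (Set.mem_univ y) (Set.mem_univ y')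
  · simp only [hbd y hy, hbd y' hy']

end Covering

/-! ### Reduced words, the vertices of the tree of sheets -/

/-- Words in the natural numbers without two equal consecutive letters. -/
def GapWord : Type := {l : List ℕ // l.IsChain (· ≠ ·)}

namespace GapWord

instance : TopologicalSpace GapWord := ⊥

instance : DiscreteTopology GapWord := ⟨rfl⟩

/-- Multiplication by the letter `j`, considered as an involution: cancel `j` against the head of
the list if possible, and prepend it otherwise. -/
def crossList (j : ℕ) (l : List ℕ) : List ℕ := if l.head? = some j then l.tail else j :: l

/-- `crossList` on reduced words. -/
def cross (j : ℕ) (v : GapWord) : GapWord :=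
  ⟨crossList j v.1, by
    obtain ⟨l, hl⟩ := v
    rcases l with _ | ⟨a, l⟩
    · simp [crossList]
    · by_cases h : a = j
      · subst h
        simpa [crossList] using hl.tail
      · simpa [crossList, h, Ne.symm h] using hl⟩

/-- The edge of direction `j` at `v` leads either towards the root (first case) or away from it. -/
theorem cross_cases (j : ℕ) (v : GapWord) :
    (∃ u : GapWord, v.1 = j :: u.1 ∧ cross j v = u ∧ u.1.head? ≠ some j) ∨
      ((cross j v).1 = j :: v.1 ∧ v.1.head? ≠ some j) := by
  obtain ⟨l, hl⟩ := v
  by_cases h : l.head? = some j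
  · left
    rcases l with _ | ⟨a, l⟩
    · simp at h
    · obtain rfl : a = j := by simpa using h
      refine ⟨⟨l, hl.tail⟩, rfl, Subtype.ext (by simp [cross, crossList]), ?_⟩
      rcases l with _ | ⟨b, l⟩
      · simp
      · simp only [List.isChain_cons_cons] at hl
        simpa using Ne.symm hl.1
  · exact Or.inr ⟨by simp [cross, crossList, h], h⟩

theorem cross_cross (j : ℕ) (v : GapWord) : cross j (cross j v) = v := by
  rcases cross_cases j v with ⟨u, hv, hu, hj⟩ | ⟨hv, hj⟩
  · rw [hu]
    exact Subtype.ext (by simp [cross, crossList, hj, hv])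
  · refine Subtype.ext ?_
    change crossList j (cross j v).1 = v.1
    simp [hv, crossList]

end GapWord

/-! ### Plane paths that follow the tree -/

section TreePath

/-- The displacement at time `t` along the path from `± i` through the real number `a` to `∓ i`,
where the sign of the starting point is `ε`. -/
noncomputable def gapStep (ε a t : ℝ) : ℂ := ⟨(1 - |1 - 2 * t|) * a, -2 * t * ε⟩

theorem continuous_complex_mk {Z : Type*} [TopologicalSpace Z] {f g : Z → ℝ} (hf : Continuous f)
    (hg : Continuous g) : Continuous fun z => (⟨f z, g z⟩ : ℂ) :=
  Complex.equivRealProdCLM.symm.continuous.comp (hf.prodMk hg)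

theorem continuous_gapStep (ε a : ℝ) : Continuous (gapStep ε a) :=
  continuous_complex_mk (by fun_prop) (by fun_prop)

theorem gapStep_zero (ε a : ℝ) : gapStep ε a 0 = 0 := by
  apply Complex.ext <;> simp [gapStep]

/-- The path in the plane which ends at `ε i` and crosses the real axis successively at the points
`q j`, where `j` runs through the letters of a word from the last one to the first one. -/
noncomputable def treePath (q : ℕ → ℝ) : ℝ → List ℕ → ℝ → ℂ
  | ε, [], _ => ⟨0, ε⟩
  | ε, j :: u, s => treePath q (-ε) u (min s u.length) + gapStep (-ε) (q j) (max 0 (s - u.length))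

variable (q : ℕ → ℝ)

theorem continuous_treePath (ε : ℝ) (l : List ℕ) : Continuous (treePath q ε l) := by
  induction l generalizing ε with
  | nil => exact continuous_const
  | cons j u ih =>
    exact ((ih (-ε)).comp (by fun_prop)).add ((continuous_gapStep _ _).comp (by fun_prop))

theorem treePath_length (ε : ℝ) (l : List ℕ) : treePath q ε l l.length = ⟨0, ε⟩ := by
  induction l generalizing ε with
  | nil => rfl
  | cons j u ih =>
    have h1 : min ((j :: u).length : ℝ) u.length = u.length := min_eq_right (by simp)
    have h2 : max 0 (((j :: u).length : ℝ) - u.length) = 1 := by simp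
    rw [treePath, h1, h2, ih]
    apply Complex.ext
    · simp [gapStep]; norm_num
    · simp [gapStep]; ring

theorem treePath_cons_of_le (ε : ℝ) (j : ℕ) (u : List ℕ) {s : ℝ} (hs : s ≤ u.length) :
    treePath q ε (j :: u) s = treePath q (-ε) u s := by
  rw [treePath, min_eq_left hs, max_eq_left (by linarith), gapStep_zero, add_zero]

theorem treePath_cons_of_ge (ε : ℝ) (j : ℕ) (u : List ℕ) {s : ℝ} (hs : u.length ≤ s) :
    treePath q ε (j :: u) s = ⟨0, -ε⟩ + gapStep (-ε) (q j) (s - u.length) := by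
  rw [treePath, min_eq_right hs, max_eq_right (by linarith), treePath_length]

theorem treePath_zero (ε : ℝ) (l : List ℕ) : treePath q ε l 0 = ⟨0, ε * (-1) ^ l.length⟩ := by
  induction l generalizing ε with
  | nil => simp [treePath]
  | cons j u ih =>
    rw [treePath_cons_of_le q ε j u (by positivity), ih, List.length_cons, pow_succ]
    apply Complex.ext <;> simp

/-- The path meets the real axis only halfway through a step, and there it sits at some `q j`. -/
theorem treePath_mem {S : Finset ℝ} (hq : ∀ j, q j ∉ S) {ε : ℝ} (hε : ε ≠ 0) (l : List ℕ) {s : ℝ}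
    (hs : s ≤ l.length) : ∀ a ∈ S, treePath q ε l s ≠ a := by
  induction l generalizing ε with
  | nil =>
    intro a _ h
    exact hε (by simpa [treePath] using congrArg Complex.im h)
  | cons j u ih =>
    rcases le_total s u.length with h | h
    · rw [treePath_cons_of_le q ε j u h]
      exact ih (neg_ne_zero.2 hε) h
    · rw [treePath_cons_of_ge q ε j u h]
      intro a ha hz
      have him := congrArg Complex.im hz
      have hre := congrArg Complex.re hz
      simp only [gapStep, Complex.add_im, Complex.add_re, Complex.ofReal_im, Complex.ofReal_re]
        at him hre
      have h2 : 1 - 2 * (s - u.length) = 0 := by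
        have : ε * (1 - 2 * (s - u.length)) = 0 := by linarith
        exact (mul_eq_zero.1 this).resolve_left hε
      rw [h2] at hre
      simp only [abs_zero, sub_zero, one_mul, zero_add] at hre
      exact hq j (hre ▸ ha)

/-- The point at time `t` on the path from the root of the tree of words to the point at distance
`κ / 2` from the vertex `v` in the direction of the neighbour `cross j v` of `v`. -/
noncomputable def treePos (ε : ℝ) (j : ℕ) (κ : ℝ) (v : GapWord) (t : ℝ) : ℂ :=
  if v.1.head? = some j then treePath q ε v.1 (t * (v.1.length - κ / 2))
  else treePath q (-ε) (j :: v.1) (t * (v.1.length + κ / 2))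

theorem continuous_treePos (ε : ℝ) (j : ℕ) (v : GapWord) :
    Continuous fun p : ℝ × ℝ => treePos q ε j p.1 v p.2 := by
  unfold treePos
  split_ifs
  · exact (continuous_treePath q _ _).comp (by fun_prop)
  · exact (continuous_treePath q _ _).comp (by fun_prop)

/-- Independence of `j` is the point: the gap index jumps above a puncture, where the closeness is
0. -/
theorem treePos_zero_left (ε : ℝ) (j : ℕ) (v : GapWord) {t : ℝ} (ht : t ≤ 1) :
    treePos q ε j 0 v t = treePath q ε v.1 (t * v.1.length) := by
  unfold treePos
  split_ifs
  · simp
  · rw [zero_div, add_zero, treePath_cons_of_le, neg_neg]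
    exact mul_le_of_le_one_left (by positivity) ht

/-- For `κ = 1` both sides follow the path to the midpoint of one edge, seen from its two ends. This
makes the contraction continuous across the gaps. -/
theorem treePos_cross (ε : ℝ) (j : ℕ) (v : GapWord) (t : ℝ) :
    treePos q (-ε) j 1 (v.cross j) t = treePos q ε j 1 v t := by
  rcases GapWord.cross_cases j v with ⟨u, hv, hu, hj⟩ | ⟨hv, hj⟩
  · have h' : v.1.head? = some j := by simp [hv]
    rw [hu, treePos, treePos, if_neg hj, if_pos h', hv, neg_neg, List.length_cons]
    congr 1
    push_cast; ring
  · have h' : (v.cross j).1.head? = some j := by simp [hv]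
    rw [treePos, treePos, if_pos h', if_neg hj, hv, List.length_cons]
    congr 1
    push_cast; ring

theorem treePos_start (ε : ℝ) (j : ℕ) (κ : ℝ) (v : GapWord) :
    treePos q ε j κ v 0 = ⟨0, ε * (-1) ^ v.1.length⟩ := by
  unfold treePos
  split_ifs
  · rw [zero_mul, treePath_zero]
  · rw [zero_mul, treePath_zero, List.length_cons, pow_succ]
    congr 1; ring

theorem treePos_end (ε : ℝ) (j : ℕ) {κ : ℝ} (h0 : 0 ≤ κ) (h1 : κ ≤ 1) (v : GapWord) :
    treePos q ε j κ v 1 = ⟨κ * q j, ε * (1 - κ)⟩ := by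
  unfold treePos
  split_ifs with h
  · obtain ⟨l, hl⟩ := v
    rcases l with _ | ⟨a, u⟩
    · simp at h
    · obtain rfl : a = j := by simpa using h
      simp only [List.length_cons]
      rw [treePath_cons_of_ge _ _ _ _ (by push_cast; linarith)]
      have : |1 - 2 * (1 * (((u.length + 1 : ℕ) : ℝ) - κ / 2) - u.length)| = 1 - κ := by
        rw [abs_of_nonpos (by push_cast; linarith)]; push_cast; ring
      apply Complex.ext
      · simp only [gapStep, this, Complex.add_re]; ring
      · simp only [gapStep, Complex.add_im]; push_cast; ring
  · rw [treePath_cons_of_ge _ _ _ _ (by linarith)]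
    have : |1 - 2 * (1 * ((v.1.length : ℝ) + κ / 2) - v.1.length)| = 1 - κ := by
      rw [abs_of_nonneg (by linarith)]; ring
    apply Complex.ext
    · simp only [gapStep, this, Complex.add_re]; ring
    · simp only [gapStep, Complex.add_im]; ring

theorem treePos_mem {S : Finset ℝ} (hq : ∀ j, q j ∉ S) {ε : ℝ} (hε : ε ≠ 0) (j : ℕ) {κ : ℝ}
    (h0 : 0 ≤ κ) (h1 : κ ≤ 1) (v : GapWord) {t : ℝ} (ht0 : 0 ≤ t) (ht1 : t ≤ 1) :
    ∀ a ∈ S, treePos q ε j κ v t ≠ a := by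
  have hl : (0 : ℝ) ≤ v.1.length := by positivity
  unfold treePos
  split_ifs with h
  · refine treePath_mem q hq hε _ ?_
    nlinarith
  · refine treePath_mem q hq (neg_ne_zero.2 hε) _ ?_
    push_cast [List.length_cons]
    nlinarith

end TreePath

/-! ### The covering of the plane with real punctures -/

section RealPunctures

variable (S : Finset ℝ)

/-- The complement in the complex plane of a finite set of real numbers. -/
def realPunctured : Set ℂ := {z | ∀ a ∈ S, z ≠ (a : ℂ)}

/-- The number of elements of `S` to the left of `x`; it distinguishes the components of `ℝ \ S`. -/
noncomputable def gapIndex (x : ℝ) : ℕ := (S.filter (· < x)).card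

theorem eventually_gapIndex_eq {x : ℝ} (hx : x ∉ S) :
    ∀ᶠ x' in 𝓝 x, gapIndex S x' = gapIndex S x := by
  have h : ∀ᶠ x' in 𝓝 x, ∀ a ∈ S, (a < x' ↔ a < x) := by
    rw [Filter.eventually_all_finset]
    intro a ha
    rcases lt_or_gt_of_ne (fun h => hx (h ▸ ha) : a ≠ x) with h | h
    · filter_upwards [lt_mem_nhds h] with x' hx'
      exact iff_of_true hx' h
    · filter_upwards [gt_mem_nhds h] with x' hx'
      exact iff_of_false hx'.le.not_gt h.le.not_gt
  filter_upwards [h] with x' hx'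
  unfold gapIndex
  congr 1
  exact Finset.filter_congr hx'

theorem gapIndex_lt {x y a : ℝ} (ha : a ∈ S) (hx : x ≤ a) (hy : a < y) :
    gapIndex S x < gapIndex S y := by
  refine Finset.card_lt_card ⟨fun b hb => ?_, fun h => ?_⟩
  · rw [Finset.mem_filter] at hb ⊢
    exact ⟨hb.1, by linarith [hb.2]⟩
  · have := h (Finset.mem_filter.2 ⟨ha, hy⟩)
    rw [Finset.mem_filter] at this
    linarith [this.2]

theorem notMem_of_gapIndex_eq {x y t : ℝ} (hx : x ∉ S) (hy : y ∉ S)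
    (h : gapIndex S x = gapIndex S y) (ht0 : 0 ≤ t) (ht1 : t ≤ 1) :
    (1 - t) * x + t * y ∉ S := by
  intro ha
  rcases lt_trichotomy x y with hxy | hxy | hxy
  · refine (gapIndex_lt S ha (x := x) (y := y) (by nlinarith) ?_).ne h
    refine lt_of_le_of_ne (by nlinarith) fun e => hy (e ▸ ha)
  · subst hxy
    exact hx (by convert ha using 1; ring)
  · refine (gapIndex_lt S ha (x := y) (y := x) (by nlinarith) ?_).ne h.symm
    refine lt_of_le_of_ne (by nlinarith) fun e => hx (e ▸ ha)

theorem exists_gapPoint : ∃ q : ℕ → ℝ, (∀ j, q j ∉ S) ∧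
    ∀ x ∉ S, gapIndex S (q (gapIndex S x)) = gapIndex S x := by
  obtain ⟨x₀, hx₀⟩ := Infinite.exists_notMem_finset S
  have : ∀ j, ∃ y, y ∉ S ∧ ∀ x ∉ S, gapIndex S x = j → gapIndex S y = j := by
    intro j
    by_cases h : ∃ x, x ∉ S ∧ gapIndex S x = j
    · obtain ⟨x, hx, hj⟩ := h
      exact ⟨x, hx, fun _ _ _ => hj⟩
    · push Not at h
      -- For an index that belongs to no gap any point outside `S` will do.
      exact ⟨x₀, hx₀, fun x hx hj => absurd hj (h x hx)⟩
  choose q hq hq' using this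
  exact ⟨q, hq, fun x hx => hq' _ x hx rfl⟩

variable {S}

theorem re_notMem_of_im_eq_zero {z : ℂ} (hz : z ∈ realPunctured S) (h : z.im = 0) : z.re ∉ S :=
  fun hS => hz _ hS (Complex.ext rfl h)

theorem mem_realPunctured_of_im_ne_zero {z : ℂ} (h : z.im ≠ 0) : z ∈ realPunctured S := by
  rintro a _ rfl
  exact h rfl

variable (S)

/-- A function vanishing exactly on `S`. -/
noncomputable def punctureDist (x : ℝ) : ℝ := ∏ a ∈ S, |x - a|

theorem continuous_punctureDist : Continuous (punctureDist S) :=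
  continuous_finsetProd _ fun a _ => by fun_prop

theorem punctureDist_nonneg (x : ℝ) : 0 ≤ punctureDist S x :=
  Finset.prod_nonneg fun _ _ => abs_nonneg _

theorem punctureDist_eq_zero {x : ℝ} : punctureDist S x = 0 ↔ x ∈ S := by
  simp [punctureDist, Finset.prod_eq_zero_iff, sub_eq_zero]

/-- A function on the punctured plane with values in `[0, 1]` which is `1` exactly on the real
axis, and vanishes on a neighbourhood of the non-real points above the punctures. -/
noncomputable def gapCloseness (z : ℂ) : ℝ :=
  max 0 (punctureDist S z.re - |z.im|) / (punctureDist S z.re + |z.im|)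

theorem gapCloseness_nonneg (z : ℂ) : 0 ≤ gapCloseness S z :=
  div_nonneg (le_max_left _ _) (add_nonneg (punctureDist_nonneg S _) (abs_nonneg _))

theorem gapCloseness_le_one (z : ℂ) : gapCloseness S z ≤ 1 := by
  have h1 := punctureDist_nonneg S z.re
  have h2 := abs_nonneg z.im
  exact div_le_one_of_le₀ (max_le (by linarith) (by linarith)) (by linarith)

theorem gapCloseness_lt_one {z : ℂ} (hz : z.im ≠ 0) : gapCloseness S z < 1 := by
  have h1 := punctureDist_nonneg S z.re
  have h2 := abs_pos.2 hz
  exact (div_lt_one (by linarith)).2 (max_lt (by linarith) (by linarith))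

theorem punctureDist_add_pos {z : ℂ} (hz : z ∈ realPunctured S) :
    0 < punctureDist S z.re + |z.im| := by
  by_cases h : z.im = 0
  · have := (punctureDist_eq_zero S).not.2 (re_notMem_of_im_eq_zero hz h)
    exact add_pos_of_pos_of_nonneg ((punctureDist_nonneg S _).lt_of_ne' this) (abs_nonneg _)
  · exact add_pos_of_nonneg_of_pos (punctureDist_nonneg S _) (abs_pos.2 h)

theorem gapCloseness_eq_one {z : ℂ} (hz : z ∈ realPunctured S) (h : z.im = 0) :
    gapCloseness S z = 1 := by
  have := punctureDist_add_pos S hz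
  simp only [h, abs_zero, add_zero] at this
  simp [gapCloseness, h, this.le, this.ne']

theorem continuous_gapCloseness : Continuous fun z : realPunctured S => gapCloseness S z := by
  have := continuous_punctureDist S
  refine Continuous.div (by fun_prop) (by fun_prop) fun z => (punctureDist_add_pos S z.2).ne'

theorem eventually_gapCloseness_eq_zero {z : realPunctured S} (h : (z : ℂ).re ∈ S) :
    ∀ᶠ z' : realPunctured S in 𝓝 z, gapCloseness S z' = 0 := by
  have hc := continuous_punctureDist S
  have him : (z : ℂ).im ≠ 0 := fun h0 => re_notMem_of_im_eq_zero z.2 h0 h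
  have : ∀ᶠ z' : realPunctured S in 𝓝 z, punctureDist S (z' : ℂ).re < |(z' : ℂ).im| := by
    refine ContinuousAt.eventually_lt (by fun_prop) (by fun_prop) ?_
    rw [(punctureDist_eq_zero S).2 h]
    exact abs_pos.2 him
  filter_upwards [this] with z' hz'
  rw [gapCloseness, max_eq_left (by linarith), zero_div]

theorem continuous_treePos_gap (q : ℕ → ℝ) (ε : ℝ) (v : GapWord) :
    Continuous fun p : I × realPunctured S =>
      treePos q ε (gapIndex S (p.2 : ℂ).re) (gapCloseness S p.2) v p.1 := by
  have hκ := continuous_gapCloseness S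
  rw [continuous_iff_continuousAt]
  rintro ⟨t, z⟩
  by_cases h : (z : ℂ).re ∈ S
  · have h1 : ∀ᶠ p : I × realPunctured S in 𝓝 (t, z), gapCloseness S p.2 = 0 :=
      continuousAt_snd.eventually (eventually_gapCloseness_eq_zero S h)
    have h2 : Continuous fun p : I × realPunctured S =>
        treePath q ε v.1 ((p.1 : ℝ) * v.1.length) :=
      (continuous_treePath q _ _).comp (by fun_prop)
    refine h2.continuousAt.congr ?_
    filter_upwards [h1] with p hp
    rw [hp, treePos_zero_left q ε _ v p.1.2.2]
  · have h0 : Filter.Tendsto (fun p : I × realPunctured S => (p.2 : ℂ).re) (𝓝 (t, z))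
        (𝓝 (z : ℂ).re) :=
      (Continuous.tendsto (by fun_prop) (t, z) : Filter.Tendsto
        (fun p : I × realPunctured S => (p.2 : ℂ).re) (𝓝 (t, z)) _)
    have h1 := h0.eventually (eventually_gapIndex_eq S h)
    have h2 : Continuous fun p : I × realPunctured S =>
        treePos q ε (gapIndex S (z : ℂ).re) (gapCloseness S p.2) v p.1 :=
      (continuous_treePos q ε (gapIndex S (z : ℂ).re) v).comp
        (f := fun p : I × realPunctured S => (gapCloseness S p.2, (p.1 : ℝ)))
        ((hκ.comp continuous_snd).prodMk (by fun_prop))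
    refine h2.continuousAt.congr ?_
    filter_upwards [h1] with p hp
    rw [hp]

/-- The covering of the punctured plane with one sheet over the closed upper half-plane and one
over the lower half-plane for each reduced word, glued across the gaps between the punctures. -/
noncomputable def gapCover : FiberBundleCore ℕ (realPunctured S) GapWord where
  baseSet j := {z | (z : ℂ).im ≠ 0 ∨ gapIndex S (z : ℂ).re = j}
  isOpen_baseSet j := by
    rw [isOpen_iff_mem_nhds]
    intro z hz
    by_cases h : (z : ℂ).im = 0
    · have h0 : Filter.Tendsto (fun p : realPunctured S => (p : ℂ).re) (𝓝 z) (𝓝 (z : ℂ).re) :=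
        Continuous.tendsto (by fun_prop) z
      filter_upwards [h0.eventually (eventually_gapIndex_eq S (re_notMem_of_im_eq_zero z.2 h))]
        with z' hz'
      exact Or.inr (hz'.trans (hz.resolve_left (not_not.2 h)))
    · have h0 : ContinuousAt (fun p : realPunctured S => (p : ℂ).im) z :=
        Continuous.continuousAt (by fun_prop)
      filter_upwards [h0.eventually_ne h] with z' hz'
      exact Or.inl hz'
  indexAt z := gapIndex S (z : ℂ).re
  mem_baseSet_at z := Or.inr rfl
  -- In every chart the coordinate is the word of an upper sheet. Below the axis, chart `i` reaches
  -- from upper sheet `v` the lower sheet `cross i v`, which chart `j` names by the upper sheet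
  -- across gap `j`.
  coordChange i j z v := if (z : ℂ).im < 0 then GapWord.cross j (GapWord.cross i v) else v
  coordChange_self i z _ v := by simp [GapWord.cross_cross]
  continuousOn_coordChange i j := by
    rintro ⟨z, v⟩ ⟨⟨hi, hj⟩, -⟩
    apply ContinuousAt.continuousWithinAt
    have hv : ∀ᶠ p : realPunctured S × GapWord in 𝓝 (z, v), p.2 = v :=
      (continuousAt_snd (p := (z, v))).eventually ((isOpen_discrete {v}).mem_nhds rfl)
    by_cases h : i = j
    · subst h
      refine (continuousAt_const (y := v)).congr ?_
      filter_upwards [hv] with p hp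
      simp [GapWord.cross_cross, hp]
    -- Distinct charts overlap only off the real axis.
    · have him : (z : ℂ).im ≠ 0 := by
        intro h0
        exact h ((hi.resolve_left (not_not.2 h0)).symm.trans (hj.resolve_left (not_not.2 h0)))
      have h0 : ContinuousAt (fun p : realPunctured S × GapWord => (p.1 : ℂ).im) (z, v) :=
        Continuous.continuousAt (by fun_prop)
      rcases lt_or_gt_of_ne him with hlt | hgt
      · refine (continuousAt_const (y := GapWord.cross j (GapWord.cross i v))).congr ?_
        filter_upwards [hv, h0.eventually_lt continuousAt_const hlt] with p hp hp'
        rw [if_pos hp', hp]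
      · refine (continuousAt_const (y := v)).congr ?_
        filter_upwards [hv, continuousAt_const.eventually_lt h0 hgt] with p hp hp'
        rw [if_neg hp'.le.not_gt, hp]
  coordChange_comp i j k z _ v := by
    split_ifs
    · simp [GapWord.cross_cross]
    · rfl

/-- The fibre coordinate of a point of the covering. -/
def fiberWord (e : (gapCover S).TotalSpace) : GapWord := e.2

/-- The word indexing the sheet of a point of the covering. -/
noncomputable def sheetWord (e : (gapCover S).TotalSpace) : GapWord :=
  if (e.proj : ℂ).im < 0 then GapWord.cross (gapIndex S (e.proj : ℂ).re) (fiberWord S e)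
  else fiberWord S e

/-- The sign of the half-plane of a complex number, real numbers counting as positive. -/
noncomputable def halfSign (z : ℂ) : ℝ := if z.im < 0 then -1 else 1

theorem halfSign_ne_zero (z : ℂ) : halfSign z ≠ 0 := by
  unfold halfSign; split_ifs <;> norm_num

/-- In the chart of the gap index at `e₀` the fibre coordinate `a` is locally constant, and there
the sheet is `a` above the axis and its neighbour across that gap below. -/
theorem eventually_sheetWord (e₀ : (gapCover S).TotalSpace) :
    ∃ a : GapWord, ∀ᶠ e : (gapCover S).TotalSpace in 𝓝 e₀,
      sheetWord S e = if (e.proj : ℂ).im < 0 then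
        GapWord.cross (gapIndex S (e₀.proj : ℂ).re) a else a := by
  let τ := (gapCover S).localTriv (gapIndex S (e₀.proj : ℂ).re)
  have hmem : e₀ ∈ τ.source := ((gapCover S).mem_localTriv_source _ _).2 (Or.inr rfl)
  have hτ : ContinuousAt τ e₀ := τ.continuousOn.continuousAt (τ.open_source.mem_nhds hmem)
  refine ⟨(τ e₀).2, ?_⟩
  have h := (continuousAt_snd.comp hτ).eventually
    ((isOpen_discrete {(τ e₀).2}).mem_nhds rfl)
  filter_upwards [h] with e he
  have hτe : (τ e).2 = if (e.proj : ℂ).im < 0 then GapWord.cross (gapIndex S (e₀.proj : ℂ).re)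
      (GapWord.cross (gapIndex S (e.proj : ℂ).re) (fiberWord S e)) else fiberWord S e := rfl
  rw [← show (τ e).2 = (τ e₀).2 from he, hτe, sheetWord]
  by_cases h0 : (e.proj : ℂ).im < 0
  · simp only [if_pos h0, GapWord.cross_cross]
  · simp only [if_neg h0]

/-- The contraction of the tree of sheets, as a map to the plane. -/
noncomputable def coverPos (q : ℕ → ℝ) (p : I × (gapCover S).TotalSpace) : ℂ :=
  treePos q (halfSign p.2.proj) (gapIndex S (p.2.proj : ℂ).re) (gapCloseness S p.2.proj)
    (sheetWord S p.2) p.1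

/-- Only real points matter: the formulas for the two half-planes are each continuous, and on the
axis the closeness is 1, so they agree by `treePos_cross`. -/
theorem continuous_coverPos (q : ℕ → ℝ) : Continuous (coverPos S q) := by
  rw [continuous_iff_continuousAt]
  rintro ⟨t₀, e₀⟩
  obtain ⟨a, ha⟩ := eventually_sheetWord S e₀
  have hproj : Continuous fun p : I × (gapCover S).TotalSpace => p.2.proj :=
    (gapCover S).continuous_proj.comp continuous_snd
  have hpair : Continuous fun p : I × (gapCover S).TotalSpace => (p.1, p.2.proj) :=
    continuous_fst.prodMk hproj
  let j₀ := gapIndex S (e₀.proj : ℂ).re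
  let F : I × (gapCover S).TotalSpace → ℂ := fun p =>
    treePos q (-1) (gapIndex S (p.2.proj : ℂ).re) (gapCloseness S p.2.proj) (a.cross j₀) p.1
  let G : I × (gapCover S).TotalSpace → ℂ := fun p =>
    treePos q 1 (gapIndex S (p.2.proj : ℂ).re) (gapCloseness S p.2.proj) a p.1
  have hF : Continuous F := (continuous_treePos_gap S q (-1) (a.cross j₀)).comp hpair
  have hG : Continuous G := (continuous_treePos_gap S q 1 a).comp hpair
  have hev : ∀ᶠ p : I × (gapCover S).TotalSpace in 𝓝 (t₀, e₀),
      coverPos S q p = if (p.2.proj : ℂ).im < 0 then F p else G p := by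
    filter_upwards [continuousAt_snd.eventually ha] with p hp
    unfold coverPos halfSign
    rw [hp]
    split_ifs <;> rfl
  refine ContinuousAt.congr ?_ (Filter.EventuallyEq.symm hev)
  have h0 : ContinuousAt (fun p : I × (gapCover S).TotalSpace => (p.2.proj : ℂ).im) (t₀, e₀) :=
    Continuous.continuousAt (by fun_prop)
  rcases lt_trichotomy (e₀.proj : ℂ).im 0 with h | h | h
  · refine hF.continuousAt.congr ?_
    filter_upwards [h0.eventually_lt continuousAt_const h] with p hp
    rw [if_pos hp]
  · have hFG : F (t₀, e₀) = G (t₀, e₀) := by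
      simp only [F, G, gapCloseness_eq_one S e₀.proj.2 h]
      exact treePos_cross q 1 j₀ a t₀
    have hF' := hF.continuousAt (x := (t₀, e₀))
    have hG' := hG.continuousAt (x := (t₀, e₀))
    unfold ContinuousAt at hF' hG' ⊢
    change Filter.Tendsto _ _ (𝓝 (if (e₀.proj : ℂ).im < 0 then F (t₀, e₀) else G (t₀, e₀)))
    rw [if_neg h.not_lt]
    rw [hFG] at hF'
    exact hF'.if' hG'
  · refine hG.continuousAt.congr ?_
    filter_upwards [continuousAt_const.eventually_lt h0 h] with p hp
    rw [if_neg hp.le.not_gt]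

/-- Crossing a gap changes both the half-plane and the parity of the word, so the starting point of
the path is unchanged. -/
theorem isLocallyConstant_coverPos_zero (q : ℕ → ℝ) :
    IsLocallyConstant fun e => coverPos S q (0, e) := by
  rw [IsLocallyConstant.iff_eventually_eq]
  intro e₀
  obtain ⟨a, ha⟩ := eventually_sheetWord S e₀
  have hlen : ∀ j, (-1 : ℝ) * (-1) ^ (a.cross j).1.length = 1 * (-1) ^ a.1.length := by
    intro j
    rcases GapWord.cross_cases j a with ⟨u, hv, hu, -⟩ | ⟨hv, -⟩
    · rw [hu, hv, List.length_cons, pow_succ]; ring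
    · rw [hv, List.length_cons, pow_succ]; ring
  have key : ∀ e : (gapCover S).TotalSpace, (sheetWord S e = if (e.proj : ℂ).im < 0 then
        GapWord.cross (gapIndex S (e₀.proj : ℂ).re) a else a) →
      coverPos S q (0, e) = ⟨0, 1 * (-1) ^ a.1.length⟩ := by
    intro e he
    unfold coverPos halfSign
    simp only [Set.Icc.coe_zero]
    rw [treePos_start, he]
    congr 1
    split_ifs
    · exact hlen _
    · rfl
  filter_upwards [ha] with e he
  rw [key e he, key e₀ ha.self_of_nhds]

/-- The segment joins `z` to the endpoint of its tree path. It stays in one open half-plane, or, for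
real `z`, in one gap. -/
theorem segment_mem_realPunctured {q : ℕ → ℝ} (hq : ∀ j, q j ∉ S)
    (hq' : ∀ x ∉ S, gapIndex S (q (gapIndex S x)) = gapIndex S x) {z : ℂ}
    (hz : z ∈ realPunctured S) {t : ℝ} (ht0 : 0 ≤ t) (ht1 : t ≤ 1) :
    (⟨(1 - t) * z.re + t * (gapCloseness S z * q (gapIndex S z.re)),
      (1 - t) * z.im + t * (halfSign z * (1 - gapCloseness S z))⟩ : ℂ) ∈ realPunctured S := by
  by_cases h : z.im = 0
  · intro a ha hza
    have hre := congrArg Complex.re hza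
    simp only [gapCloseness_eq_one S hz h, one_mul, Complex.ofReal_re] at hre
    have hx := re_notMem_of_im_eq_zero hz h
    exact notMem_of_gapIndex_eq S hx (hq _) (hq' _ hx).symm ht0 ht1 (hre ▸ ha)
  · refine mem_realPunctured_of_im_ne_zero ?_
    have hκ := gapCloseness_lt_one S h
    unfold halfSign
    dsimp only
    rcases lt_or_gt_of_ne h with h' | h'
    · rw [if_pos h']
      apply ne_of_lt
      rcases ht0.eq_or_lt with rfl | ht
      · linarith
      · nlinarith [mul_pos ht (sub_pos.2 hκ)]
    · rw [if_neg h'.le.not_gt]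
      apply ne_of_gt
      rcases ht0.eq_or_lt with rfl | ht
      · linarith
      · nlinarith [mul_pos ht (sub_pos.2 hκ)]

theorem loopsContract_realPunctured {N : Type*} [Fintype N] [Nontrivial N] [DecidableEq N] :
    LoopsContract N (realPunctured S) := by
  obtain ⟨q, hq, hq'⟩ := exists_gapPoint S
  have hcov : IsCoveringMap (gapCover S).proj := FiberBundle.isCoveringMap
  have hproj := (gapCover S).continuous_proj
  have hpos := continuous_coverPos S q
  have hend : ∀ e, coverPos S q (1, e) = ⟨gapCloseness S e.proj * q (gapIndex S (e.proj : ℂ).re),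
      halfSign e.proj * (1 - gapCloseness S e.proj)⟩ := fun e =>
    treePos_end q _ _ (gapCloseness_nonneg S _) (gapCloseness_le_one S _) _
  have hmem : ∀ p, coverPos S q p ∈ realPunctured S := fun p =>
    treePos_mem q hq (halfSign_ne_zero _) _ (gapCloseness_nonneg S _) (gapCloseness_le_one S _) _
      p.1.2.1 p.1.2.2
  let f₀ : C((gapCover S).TotalSpace, realPunctured S) := ⟨(gapCover S).proj, hproj⟩
  let f₁ : C((gapCover S).TotalSpace, realPunctured S) :=
    ⟨fun e => ⟨coverPos S q (1, e), hmem _⟩, Continuous.subtype_mk (by fun_prop) _⟩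
  let f₂ : C((gapCover S).TotalSpace, realPunctured S) :=
    ⟨fun e => ⟨coverPos S q (0, e), hmem _⟩, Continuous.subtype_mk (by fun_prop) _⟩
  have h₁ : f₀.Homotopic f₁ := by
    refine ⟨⟨⟨fun p => ⟨(1 - (p.1 : ℝ)) * ((p.2.proj : realPunctured S) : ℂ) +
      (p.1 : ℝ) * coverPos S q (1, p.2), ?_⟩, ?_⟩, ?_, ?_⟩⟩
    · convert segment_mem_realPunctured S hq hq' p.2.proj.2 p.1.2.1 p.1.2.2 using 1
      rw [hend]
      apply Complex.ext <;> simp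
    · refine Continuous.subtype_mk ?_ _
      have : Continuous fun p : I × (gapCover S).TotalSpace => p.2.proj := hproj.comp continuous_snd
      fun_prop
    · intro e; ext; simp [f₀]
    · intro e; ext; simp [f₁]
  have h₂ : f₁.Homotopic f₂ := by
    refine ⟨⟨⟨fun p => ⟨coverPos S q (σ p.1, p.2), hmem _⟩, ?_⟩, ?_, ?_⟩⟩
    · exact Continuous.subtype_mk (by fun_prop) _
    · intro e; simp [f₁]
    · intro e; simp [f₂]
  obtain ⟨K⟩ := h₁.trans h₂
  refine hcov.loopsContract (fun z => ⟨⟨z, (⟨[], List.isChain_nil⟩ : GapWord)⟩, rfl⟩) K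
    K.continuous K.apply_zero ?_
  have hlc := isLocallyConstant_coverPos_zero S q
  rw [IsLocallyConstant.iff_eventually_eq] at hlc ⊢
  intro e
  filter_upwards [hlc e] with e' he'
  rw [K.apply_one, K.apply_one]
  exact Subtype.ext he'

end RealPunctures

/-! ### Arbitrary finite sets of punctures -/

section Punctures

variable {N : Type*} [Fintype N] [Nontrivial N] [DecidableEq N]

theorem exists_shear_injOn (S : Finset ℂ) :
    ∃ c : ℝ, Set.InjOn (fun z : ℂ => z.re + c * z.im) S := by
  obtain ⟨c, hc⟩ := Infinite.exists_notMem_finset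
    ((S ×ˢ S).image fun p => -(p.1.re - p.2.re) / (p.1.im - p.2.im))
  refine ⟨c, fun a ha b hb hab => ?_⟩
  dsimp only at hab
  by_cases him : a.im = b.im
  · rw [him] at hab
    exact Complex.ext (by linarith) him
  · refine absurd (Finset.mem_image.2 ⟨(a, b), Finset.mem_product.2 ⟨ha, hb⟩, ?_⟩) hc
    have : a.im - b.im ≠ 0 := sub_ne_zero.2 him
    rw [div_eq_iff this]
    linarith

/-- The complement of a finite set in the plane has vanishing homotopy groups in all degrees at
least two. -/
theorem loopsContract_punctured (S : Finset ℂ) :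
    LoopsContract N {z : ℂ | ∀ a ∈ S, z ≠ a} := by
  obtain ⟨c, hc⟩ := exists_shear_injOn S
  let L : ℂ → ℝ := fun z => z.re + c * z.im
  let h : Polynomial ℝ := Lagrange.interpolate S L Complex.im
  have hL : ∀ a ∈ S, h.eval (L a) = a.im := fun a ha => Lagrange.eval_interpolate_at_node _ hc ha
  have hLc : Continuous L := by fun_prop
  -- A shear separates the first coordinates of the punctures; subtracting the interpolating
  -- polynomial then puts them on the real axis.
  let φ : ℂ → ℂ := fun z => ⟨L z, z.im - h.eval (L z)⟩
  let ψ : ℂ → ℂ := fun w => ⟨w.re - c * (w.im + h.eval w.re), w.im + h.eval w.re⟩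
  have hφ : Continuous φ := continuous_complex_mk hLc (by fun_prop)
  have hψ : Continuous ψ := continuous_complex_mk (by fun_prop) (by fun_prop)
  have hψφ : ∀ z, ψ (φ z) = z := fun z => by
    apply Complex.ext <;> simp [φ, ψ, L]
  have hφψ : ∀ z, φ (ψ z) = z := fun z => by
    apply Complex.ext <;> simp [φ, ψ, L]
  have hφa : ∀ a ∈ S, φ a = (L a : ℂ) := fun a ha => by
    apply Complex.ext <;> simp [φ, hL a ha]
  refine (loopsContract_realPunctured (S.image L)).of_retract
    ⟨fun z => ⟨φ z, fun a ha hz => ?_⟩, by fun_prop⟩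
    ⟨fun w => ⟨ψ w, fun a ha hw => ?_⟩, by fun_prop⟩ fun z => Subtype.ext (hψφ z)
  · obtain ⟨b, hb, rfl⟩ := Finset.mem_image.1 ha
    rw [← hφa b hb] at hz
    exact z.2 b hb (by rw [← hψφ z, hz, hψφ])
  · refine w.2 (L a) (Finset.mem_image_of_mem L ha) ?_
    rw [← hφa a ha, ← hw, hφψ]

end Punctures

/-! ### Pushing a map away from moving points -/

section PointPush

variable {ι : Type*} [Fintype ι]

/-- The perturbation of the identity of the plane that moves each of finitely many points `p i` by
the vector `d i`, with support in discs of radius `ε`. -/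
noncomputable def pointPush (ε : ℝ) (p d : ι → ℂ) (z : ℂ) : ℂ :=
  z + ∑ i, d i * (max 0 (1 - ‖z - p i‖ / ε) : ℝ)

theorem Continuous.pointPush {Z : Type*} [TopologicalSpace Z] (ε : ℝ) {p d : ι → Z → ℂ} {z : Z → ℂ}
    (hp : ∀ i, Continuous (p i)) (hd : ∀ i, Continuous (d i)) (hz : Continuous z) :
    Continuous fun x => pointPush ε (fun i => p i x) (fun i => d i x) (z x) := by
  unfold _root_.pointPush
  fun_prop

theorem pointPush_zero (ε : ℝ) (p : ι → ℂ) (z : ℂ) : pointPush ε p (fun _ => 0) z = z := by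
  simp [pointPush]

/-- The perturbation of the identity has Lipschitz constant at most `∑ ‖d i‖ / ε < 1`, so the push
is injective, and by the separation it sends `p i` exactly to `p i + d i`. -/
theorem pointPush_ne {ε : ℝ} (hε : 0 < ε) {p d : ι → ℂ}
    (hp : ∀ i j, i ≠ j → ε ≤ ‖p i - p j‖) (hd : ∑ i, ‖d i‖ < ε) {z : ℂ} {i : ι} (hz : z ≠ p i) :
    pointPush ε p d z ≠ p i + d i := by
  have hpi : pointPush ε p d (p i) = p i + d i := by
    unfold pointPush
    rw [Finset.sum_eq_single i]
    · simp
    · intro j _ hj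
      have : 1 ≤ ‖p i - p j‖ / ε := (one_le_div hε).2 (hp i j hj.symm)
      rw [max_eq_left (by linarith)]
      simp
    · simp
  rw [← hpi]
  intro h
  have hlip : ∀ j, ‖(d j * (max 0 (1 - ‖p i - p j‖ / ε) : ℝ) -
      d j * (max 0 (1 - ‖z - p j‖ / ε) : ℝ) : ℂ)‖ ≤ ‖d j‖ * (‖z - p i‖ / ε) := by
    intro j
    rw [← mul_sub, norm_mul, ← Complex.ofReal_sub, Complex.norm_real, Real.norm_eq_abs]
    refine mul_le_mul_of_nonneg_left ?_ (norm_nonneg _)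
    refine (abs_max_sub_max_le_max _ _ _ _).trans ?_
    rw [sub_self, abs_zero, max_eq_right (abs_nonneg _)]
    have e : 1 - ‖p i - p j‖ / ε - (1 - ‖z - p j‖ / ε) = (‖z - p j‖ - ‖p i - p j‖) / ε := by ring
    rw [e, abs_div, abs_of_pos hε]
    gcongr
    refine (abs_norm_sub_norm_le _ _).trans ?_
    simp
  have hsub : z - p i = ∑ j, (d j * (max 0 (1 - ‖p i - p j‖ / ε) : ℝ) -
      d j * (max 0 (1 - ‖z - p j‖ / ε) : ℝ) : ℂ) := by
    rw [Finset.sum_sub_distrib]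
    unfold pointPush at h
    linear_combination h
  have hpos : 0 < ‖z - p i‖ := norm_pos_iff.2 (sub_ne_zero.2 hz)
  have h1 : ‖z - p i‖ ≤ (∑ j, ‖d j‖) * (‖z - p i‖ / ε) := by
    conv_lhs => rw [hsub]
    rw [Finset.sum_mul]
    exact (norm_sum_le _ _).trans (Finset.sum_le_sum fun j _ => hlip j)
  have h2 : (∑ j, ‖d j‖) * (‖z - p i‖ / ε) < ε * (‖z - p i‖ / ε) := by gcongr
  rw [mul_div_cancel₀ _ hε.ne'] at h2
  linarith

variable {Q : Type*} [TopologicalSpace Q] [CompactSpace Q]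

theorem exists_uniform_separation (R : ι → I × Q → ℂ) (hR : ∀ i, Continuous (R i))
    (hd : ∀ i j, i ≠ j → ∀ p, R i p ≠ R j p) :
    ∃ ε > 0, ∀ i j, i ≠ j → ∀ p, ε ≤ ‖R i p - R j p‖ := by
  have : ∀ᶠ ε : ℝ in 𝓝[>] 0, ∀ i j, i ≠ j → ∀ p, ε ≤ ‖R i p - R j p‖ := by
    rw [Filter.eventually_all]; intro i
    rw [Filter.eventually_all]; intro j
    by_cases hij : i = j
    · simp [hij]
    · obtain ⟨δ, hδ, h⟩ := isCompact_univ.exists_forall_le'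
        (f := fun p => ‖R i p - R j p‖) (by have := hR i; have := hR j; fun_prop)
        (a := 0) (fun p _ => norm_pos_iff.2 (sub_ne_zero.2 (hd i j hij p)))
      filter_upwards [Ioo_mem_nhdsGT hδ] with ε hε _ p
      exact hε.2.le.trans (h p (Set.mem_univ _))
  obtain ⟨ε, h, hε⟩ := (this.and self_mem_nhdsWithin).exists
  exact ⟨ε, hε, h⟩

theorem exists_uniform_step (R : ι → I × Q → ℂ) (hR : ∀ i, Continuous (R i)) {ε : ℝ} (hε : 0 < ε) :
    ∃ δ > 0, ∀ t t' : I, dist t t' < δ → ∀ x, ∑ i, ‖R i (t, x) - R i (t', x)‖ < ε := by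
  let F : C(I × Q, ι → ℂ) := ⟨fun p i => R i p, continuous_pi hR⟩
  have hF := CompactSpace.uniformContinuous_of_continuous F.curry.continuous
  obtain ⟨δ, hδ, h⟩ := Metric.uniformContinuous_iff.1 hF (ε / (Fintype.card ι + 1)) (by positivity)
  refine ⟨δ, hδ, fun t t' htt x => ?_⟩
  have h1 : dist (F.curry t x) (F.curry t' x) < ε / (Fintype.card ι + 1) :=
    (ContinuousMap.dist_apply_le_dist x).trans_lt (h htt)
  calc ∑ i, ‖R i (t, x) - R i (t', x)‖ ≤ ∑ _i : ι, ε / (Fintype.card ι + 1) := by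
        refine Finset.sum_le_sum fun i _ => ?_
        rw [← dist_eq_norm]
        exact (dist_le_pi_dist (F.curry t x) (F.curry t' x) i).trans h1.le
    _ = Fintype.card ι * (ε / (Fintype.card ι + 1)) := by simp
    _ < ε := by
        rw [← mul_div_assoc, div_lt_iff₀ (by positivity)]
        linarith

/-- A map avoiding finitely many distinct points can be carried along when the points move without
colliding, and it need not be changed where the points are at rest. -/
theorem exists_avoiding_lift (R : ι → I × Q → ℂ) (hR : ∀ i, Continuous (R i))
    (hd : ∀ i j, i ≠ j → ∀ p, R i p ≠ R j p) (z₀ : Q → ℂ) (hz₀ : Continuous z₀)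
    (hne : ∀ i x, z₀ x ≠ R i (0, x)) :
    ∃ Z : I × Q → ℂ, Continuous Z ∧ (∀ x, Z (0, x) = z₀ x) ∧ (∀ i p, Z p ≠ R i p) ∧
      ∀ x, (∀ i t, R i (t, x) = R i (0, x)) → ∀ t, Z (t, x) = z₀ x := by
  obtain ⟨ε, hε, hsep⟩ := exists_uniform_separation R hR hd
  obtain ⟨δ, hδ, hstep⟩ := exists_uniform_step R hR hε
  obtain ⟨m, hm⟩ := exists_nat_one_div_lt hδ
  let τ : ℕ → I := fun k => Set.projIcc 0 1 zero_le_one ((k : ℝ) / (m + 1))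
  have hτ0 : τ 0 = 0 := Set.projIcc_of_le_left _ (by simp)
  have hτ1 : τ (m + 1) = 1 := Set.projIcc_of_right_le _ (by
    push_cast
    rw [div_self (by positivity)])
  have hτd : ∀ k t, dist (min t (τ (k + 1))) (min t (τ k)) < δ := by
    intro k t
    refine lt_of_le_of_lt ?_ hm
    have h1 : dist (τ (k + 1)) (τ k) ≤ 1 / ((m : ℝ) + 1) := by
      rw [Subtype.dist_eq, Real.dist_eq]
      simp only [τ, Set.coe_projIcc]
      refine (abs_max_sub_max_le_max _ _ _ _).trans ?_
      rw [sub_self, abs_zero, max_eq_right (abs_nonneg _)]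
      refine (abs_min_sub_min_le_max _ _ _ _).trans ?_
      rw [sub_self, abs_zero, max_eq_right (abs_nonneg _), ← sub_div]
      push_cast
      rw [add_sub_cancel_left, abs_of_nonneg (by positivity)]
    refine le_trans ?_ h1
    simp only [Subtype.dist_eq, Real.dist_eq]
    have hc : ∀ a b : I, ((min a b : I) : ℝ) = min (a : ℝ) b := fun a b =>
      (Subtype.mono_coe _).map_min
    rw [hc, hc]
    refine (abs_min_sub_min_le_max _ _ _ _).trans ?_
    rw [sub_self, abs_zero, max_eq_right (abs_nonneg _)]
  have key : ∀ k : ℕ, ∃ Z : I × Q → ℂ, Continuous Z ∧ (∀ x, Z (0, x) = z₀ x) ∧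
      (∀ i p, Z p ≠ R i (min p.1 (τ k), p.2)) ∧
      ∀ x, (∀ i t, R i (t, x) = R i (0, x)) → ∀ t, Z (t, x) = z₀ x := by
    intro k
    induction k with
    | zero =>
      refine ⟨fun p => z₀ p.2, by fun_prop, fun _ => rfl, fun i p => ?_, fun _ _ _ => rfl⟩
      rw [hτ0, min_eq_right (show (0 : I) ≤ p.1 from p.1.2.1)]
      exact hne i p.2
    | succ k ih =>
      obtain ⟨Z, hZ, hZ0, hZne, hZst⟩ := ih
      -- The points move with a clock stopped at `τ k`; one push carries them on to the clock
      -- stopped at `τ (k + 1)`, and it is the identity where they rest.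
      refine ⟨fun p => pointPush ε (fun i => R i (min p.1 (τ k), p.2))
        (fun i => R i (min p.1 (τ (k + 1)), p.2) - R i (min p.1 (τ k), p.2)) (Z p), ?_, ?_, ?_, ?_⟩
      · refine Continuous.pointPush (p := fun i (p : I × Q) => R i (min p.1 (τ k), p.2))
          (d := fun i (p : I × Q) => R i (min p.1 (τ (k + 1)), p.2) - R i (min p.1 (τ k), p.2))
          ε (fun i => ?_) (fun i => ?_) hZ
        · have := hR i; fun_prop
        · have := hR i; fun_prop
      · intro x
        have h0 : ∀ a : I, min 0 a = 0 := fun a => min_eq_left a.2.1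
        simp only [h0, sub_self, pointPush_zero, hZ0]
      · intro i p
        have := pointPush_ne hε (p := fun i => R i (min p.1 (τ k), p.2))
          (d := fun i => R i (min p.1 (τ (k + 1)), p.2) - R i (min p.1 (τ k), p.2))
          (fun i j hij => hsep i j hij _) (hstep _ _ (hτd k p.1) p.2) (hZne i p)
        simpa using this
      · intro x hx t
        have h0 : ∀ i a, R i (a, x) = R i (0, x) := hx
        simp only [h0 _ (min t _), sub_self, pointPush_zero, hZst x hx]
  obtain ⟨Z, hZ, hZ0, hZne, hZst⟩ := key (m + 1)
  refine ⟨Z, hZ, hZ0, fun i p => ?_, hZst⟩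
  have := hZne i p
  rwa [hτ1, min_eq_left (show p.1 ≤ (1 : I) from p.1.2.2)] at this

end PointPush

/-! ### Complements of disjoint sections -/

section Fibration

variable {N : Type*} [Fintype N] [Nontrivial N] [DecidableEq N]
variable {ι : Type*} [Fintype ι] {B : Type*} [TopologicalSpace B]

/-- A null-homotopy of the projected loop lifts, fixed on the boundary of the cube, and ends at a
loop in the punctured plane over `b₀`. -/
theorem LoopsContract.complement_sections (hB : LoopsContract N B) (ρ : ι → B → ℂ)
    (hρ : ∀ i, Continuous (ρ i)) (hd : ∀ i j, i ≠ j → ∀ b, ρ i b ≠ ρ j b) :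
    LoopsContract N {p : B × ℂ | ∀ i, p.2 ≠ ρ i p.1} := by
  rintro ⟨⟨b₀, w₀⟩, hw₀⟩ f
  obtain ⟨H, hc, h0, h1, hb⟩ := (hB _ (GenLoop.map ⟨fun p => p.1.1, by fun_prop⟩ f)).exists_continuous
  simp only [ContinuousMap.coe_mk, GenLoop.const_apply] at h0 h1 hb
  have hf : Continuous f := f.1.continuous
  have hbf : ∀ y ∈ Cube.boundary N, (f y).1 = (b₀, w₀) := fun y hy => by
    rw [GenLoop.boundary f y hy]
  obtain ⟨Z, hZ, hZ0, hZne, hZst⟩ := exists_avoiding_lift (Q := I^N) (fun i p => ρ i (H p))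
    (fun i => (hρ i).comp hc) (fun i j hij p => hd i j hij _) (fun y => (f y).1.2)
    (by fun_prop) (fun i y => by rw [h0]; exact (f y).2 i)
  have hZb : ∀ t, ∀ y ∈ Cube.boundary N, Z (t, y) = w₀ := by
    intro t y hy
    rw [hZst y (fun i t => by rw [hb t y hy, hb 0 y hy]) t, hbf y hy]
  classical
  let S : Finset ℂ := Finset.univ.image fun i => ρ i b₀
  have hS : ∀ w, w ∈ {z : ℂ | ∀ a ∈ S, z ≠ a} ↔ ∀ i, w ≠ ρ i b₀ := fun w => by simp [S]
  let g : Ω^ N {z : ℂ | ∀ a ∈ S, z ≠ a} ⟨w₀, (hS _).2 hw₀⟩ :=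
    ⟨⟨fun y => ⟨Z (1, y), (hS _).2 fun i => by
      have := hZne i (1, y)
      rwa [h1] at this⟩, by fun_prop⟩, fun y hy => Subtype.ext (hZb 1 y hy)⟩
  let j : C({z : ℂ | ∀ a ∈ S, z ≠ a}, {p : B × ℂ | ∀ i, p.2 ≠ ρ i p.1}) :=
    ⟨fun w => ⟨(b₀, w.1), (hS _).1 w.2⟩, by fun_prop⟩
  let f' : Ω^ N {p : B × ℂ | ∀ i, p.2 ≠ ρ i p.1} ⟨(b₀, w₀), hw₀⟩ := GenLoop.map j g
  have e₁ : GenLoop.Homotopic f f' := by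
    refine GenLoop.homotopic_of_continuous (fun p => ⟨(H p, Z p), fun i => hZne i p⟩)
      (by fun_prop) ?_ ?_ ?_
    · intro y; exact Subtype.ext (Prod.ext (h0 y) (hZ0 y))
    · intro y; exact Subtype.ext (Prod.ext (h1 y) rfl)
    · intro t y hy; exact Subtype.ext (Prod.ext (hb t y hy) (hZb t y hy))
  exact e₁.trans ((loopsContract_punctured S _ g).map j)

end Fibration

/-! ### Complements of lines in ℂ² -/

section Lines

open ComplexConjugate

variable {N : Type*} [Fintype N] [Nontrivial N] [DecidableEq N]
variable {ι : Type*} [Fintype ι] {B : Type*} [TopologicalSpace B]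

theorem mul_conj_add_mul_conj_ne_zero {x y : ℂ} (h : x ≠ 0 ∨ y ≠ 0) :
    x * conj x + y * conj y ≠ 0 := by
  rw [Complex.mul_conj, Complex.mul_conj, ← Complex.ofReal_add, Complex.ofReal_ne_zero]
  have h1 := Complex.normSq_nonneg x
  have h2 := Complex.normSq_nonneg y
  rcases h with h | h
  · have := Complex.normSq_pos.2 h
    positivity
  · have := Complex.normSq_pos.2 h
    positivity

/-- Removing from a trivial bundle with fibre `ℂ²` finitely many continuously varying lines, which
are pairwise distinct in each fibre, does not create homotopy groups in degrees at least two. -/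
theorem LoopsContract.complement_lines (hB : LoopsContract N B) (x y : ι → B → ℂ)
    (hx : ∀ i, Continuous (x i)) (hy : ∀ i, Continuous (y i)) (i₀ : ι)
    (h₀ : ∀ b, x i₀ b ≠ 0 ∨ y i₀ b ≠ 0)
    (hd : ∀ i j, i ≠ j → ∀ b, x i b * y j b - x j b * y i b ≠ 0) :
    LoopsContract N {p : B × ℂ × ℂ | ∀ i, x i p.1 * p.2.2 - p.2.1 * y i p.1 ≠ 0} := by
  classical
  let n : B → ℂ := fun b => x i₀ b * conj (x i₀ b) + y i₀ b * conj (y i₀ b)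
  have hn : ∀ b, n b ≠ 0 := fun b => mul_conj_add_mul_conj_ne_zero (h₀ b)
  have hnc : Continuous n := by have := hx i₀; have := hy i₀; fun_prop
  -- A vector off line `i₀` is uniquely `c (z e + e')` with `c ≠ 0`, where `e` spans that line and
  -- `e'` is orthogonal to `e`. The remaining lines become the conditions `z ≠ ρ i`.
  let u : B → ℂ → ℂ := fun b z => z * x i₀ b - conj (y i₀ b)
  let w : B → ℂ → ℂ := fun b z => z * y i₀ b + conj (x i₀ b)
  let D : {i // i ≠ i₀} → B → ℂ := fun i b => x i b * y i₀ b - x i₀ b * y i b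
  let A : {i // i ≠ i₀} → B → ℂ := fun i b => x i b * conj (x i₀ b) + conj (y i₀ b) * y i b
  have hD : ∀ i b, D i b ≠ 0 := fun i b => hd i i₀ i.2 b
  let ρ : {i // i ≠ i₀} → B → ℂ := fun i b => -A i b / D i b
  have hρc : ∀ i, Continuous (ρ i) := by
    intro i
    have := hx i; have := hy i; have := hx i₀; have := hy i₀
    exact Continuous.div (by fun_prop) (by fun_prop) (hD i)
  have hline : ∀ (i : {i // i ≠ i₀}) b z, x (i : ι) b * w b z - u b z * y (i : ι) b = D i b * (z - ρ i b) := by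
    intro i b z
    simp only [u, w, ρ]
    rw [mul_sub, mul_div_cancel₀ _ (hD i b)]
    simp only [A, D]
    ring
  have hline₀ : ∀ b z, x i₀ b * w b z - u b z * y i₀ b = n b := by
    intro b z
    simp only [u, w, n]
    ring
  have hρd : ∀ i j, i ≠ j → ∀ b, ρ i b ≠ ρ j b := by
    intro i j hij b h
    have h1 := hline i b (ρ i b)
    have h2 := hline j b (ρ i b)
    rw [sub_self, mul_zero] at h1
    rw [h, sub_self, mul_zero, ← h] at h2
    have hdij := hd i j (fun e => hij (Subtype.ext e)) b
    -- A vector on two distinct lines vanishes, while `(u, w)` never lies on line `i₀`.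
    have hu : u b (ρ i b) = 0 := by
      refine (mul_eq_zero.1 ?_).resolve_left hdij
      linear_combination x (j : ι) b * h1 - x (i : ι) b * h2
    have hw : w b (ρ i b) = 0 := by
      refine (mul_eq_zero.1 ?_).resolve_left hdij
      linear_combination y (j : ι) b * h1 - y (i : ι) b * h2
    have := hline₀ b (ρ i b)
    rw [hu, hw] at this
    exact hn b (by rw [← this]; ring)
  have hC : LoopsContract N {z : ℂ | ∀ a ∈ ({0} : Finset ℂ), z ≠ a} := loopsContract_punctured _
  let c : B × ℂ × ℂ → ℂ := fun p => (x i₀ p.1 * p.2.2 - p.2.1 * y i₀ p.1) / n p.1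
  let ζ : B × ℂ × ℂ → ℂ := fun p => (p.2.1 * conj (x i₀ p.1) + p.2.2 * conj (y i₀ p.1)) /
    (x i₀ p.1 * p.2.2 - p.2.1 * y i₀ p.1)
  have hc : Continuous c := by
    have := hx i₀; have := hy i₀
    exact Continuous.div (by fun_prop) (by fun_prop) fun p => hn _
  have hcu : ∀ p, x i₀ p.1 * p.2.2 - p.2.1 * y i₀ p.1 ≠ 0 → c p * u p.1 (ζ p) = p.2.1 := by
    intro p hp
    have := hn p.1
    simp only [c, u, ζ]
    field_simp
    simp only [n]
    ring
  have hcw : ∀ p, x i₀ p.1 * p.2.2 - p.2.1 * y i₀ p.1 ≠ 0 → c p * w p.1 (ζ p) = p.2.2 := by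
    intro p hp
    have := hn p.1
    simp only [c, w, ζ]
    field_simp
    simp only [n]
    ring
  refine (hC.prod (hB.complement_sections ρ hρc hρd)).of_retract
    ⟨fun p => (⟨c p.1, ?_⟩, ⟨(p.1.1, ζ p.1), ?_⟩), ?_⟩
    ⟨fun p => ⟨(p.2.1.1, (p.1 : ℂ) * u p.2.1.1 p.2.1.2, (p.1 : ℂ) * w p.2.1.1 p.2.1.2), ?_⟩, ?_⟩ ?_
  · intro a ha
    rw [Finset.mem_singleton.1 ha]
    exact div_ne_zero (p.2 i₀) (hn _)
  · intro i h
    have h1 := p.2 i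
    dsimp only at h
    rw [← hcu p.1 (p.2 i₀), ← hcw p.1 (p.2 i₀)] at h1
    apply h1
    have h2 := hline i p.1.1 (ζ p.1)
    rw [h, sub_self, mul_zero, ← h] at h2
    linear_combination c p.1 * h2
  · have := hx i₀; have := hy i₀
    refine Continuous.prodMk (by fun_prop) (Continuous.subtype_mk (Continuous.prodMk (by fun_prop) ?_) _)
    exact Continuous.div (by fun_prop) (by fun_prop) fun p => p.2 i₀
  · intro i
    have hp0 : (p.1 : ℂ) ≠ 0 := p.1.2 0 (by simp)
    by_cases hi : i = i₀
    · subst hi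
      have h2 := hline₀ p.2.1.1 p.2.1.2
      have : x i p.2.1.1 * ((p.1 : ℂ) * w p.2.1.1 p.2.1.2) -
          (p.1 : ℂ) * u p.2.1.1 p.2.1.2 * y i p.2.1.1 = p.1 * n p.2.1.1 := by
        linear_combination (p.1 : ℂ) * h2
      dsimp only
      rw [this]
      exact mul_ne_zero hp0 (hn _)
    · have h2 := hline ⟨i, hi⟩ p.2.1.1 p.2.1.2
      have : x i p.2.1.1 * ((p.1 : ℂ) * w p.2.1.1 p.2.1.2) -
          (p.1 : ℂ) * u p.2.1.1 p.2.1.2 * y i p.2.1.1 =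
            p.1 * (D ⟨i, hi⟩ p.2.1.1 * (p.2.1.2 - ρ ⟨i, hi⟩ p.2.1.1)) := by
        linear_combination (p.1 : ℂ) * h2
      dsimp only
      rw [this]
      exact mul_ne_zero hp0 (mul_ne_zero (hD _ _) (sub_ne_zero.2 (p.2.2 ⟨i, hi⟩)))
  · have := hx i₀; have := hy i₀
    fun_prop
  · intro p
    exact Subtype.ext (Prod.ext rfl (Prod.ext (hcu p.1 (p.2 i₀)) (hcw p.1 (p.2 i₀))))

end Lines

/-! ### Homotopy groups of a product -/

section HomotopyGroupMap

variable {N X Y Z : Type*} [TopologicalSpace X] [TopologicalSpace Y] [TopologicalSpace Z]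

theorem GenLoop.map_transAt [DecidableEq N] (φ : C(X, Y)) (i : N) {x : X} (f g : Ω^ N X x) :
    GenLoop.map φ (GenLoop.transAt i f g) =
      GenLoop.transAt i (GenLoop.map φ f) (GenLoop.map φ g) := by
  ext t
  simp only [GenLoop.map_apply, GenLoop.transAt, GenLoop.coe_copy]
  split_ifs <;> rfl

/-- The projection from a product to a factor induces an isomorphism on homotopy groups if the
homotopy groups of the other factor vanish. -/
theorem nonempty_homotopyGroup_mulEquiv_of_prod [DecidableEq N] [Nonempty N] (φ : C(X, Z))
    (η : C(X, Y)) (ψ : C(Z × Y, X)) (hψ : ∀ x, ψ (φ x, η x) = x) (hφ : ∀ p, φ (ψ p) = p.1)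
    (hY : LoopsContract N Y) (x : X) {z : Z} (hz : φ x = z) :
    Nonempty (HomotopyGroup N X x ≃* HomotopyGroup N Z z) := by
  subst hz
  let Φ : HomotopyGroup N X x → HomotopyGroup N Z (φ x) :=
    Quotient.map (GenLoop.map φ) fun f g h => GenLoop.Homotopic.map h φ
  have hmul : ∀ a b, Φ (a * b) = Φ a * Φ b := by
    intro a b
    induction a using Quotient.inductionOn with | _ f
    induction b using Quotient.inductionOn with | _ g
    let i : N := Classical.arbitrary N
    refine (congrArg Φ (HomotopyGroup.mul_spec (i := i))).trans
      (Eq.trans ?_ (HomotopyGroup.mul_spec (i := i) (p := GenLoop.map φ f)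
        (q := GenLoop.map φ g)).symm)
    -- The product of the classes of `f` and `g` is represented by `transAt i g f`, hence the
    -- reversed order.
    exact congrArg (fun h => (⟦h⟧ : Quotient (GenLoop.Homotopic.setoid N (φ x))))
      (GenLoop.map_transAt φ i g f)
  have hinj : Function.Injective Φ := by
    intro a b hab
    induction a using Quotient.inductionOn with | _ f
    induction b using Quotient.inductionOn with | _ g
    obtain ⟨H, hc, h0, h1, hb⟩ :=
      (Quotient.exact hab : GenLoop.Homotopic (GenLoop.map φ f) (GenLoop.map φ g)).exists_continuous
    obtain ⟨K, kc, k0, k1, kb⟩ :=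
      ((hY _ (GenLoop.map η f)).trans (hY _ (GenLoop.map η g)).symm).exists_continuous
    refine Quotient.sound (GenLoop.homotopic_of_continuous (fun p => ψ (H p, K p)) (by fun_prop)
      (fun y => ?_) (fun y => ?_) fun t y hy => ?_)
    · rw [h0, k0]; exact hψ _
    · rw [h1, k1]; exact hψ _
    · rw [hb t y hy, kb t y hy]; exact hψ _
  have hsurj : Function.Surjective Φ := by
    intro b
    induction b using Quotient.inductionOn with | _ g
    let f : Ω^ N X x := ⟨⟨fun y => ψ (g y, η x), by
      have : Continuous g := g.1.continuous
      fun_prop⟩, fun y hy => by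
        change ψ (g y, η x) = x
        rw [GenLoop.boundary g y hy, hψ]⟩
    refine ⟨⟦f⟧, ?_⟩
    change (⟦GenLoop.map φ f⟧ : HomotopyGroup N Z (φ x)) = ⟦g⟧
    congr 1
    ext y
    exact hφ (g y, η x)
  exact ⟨MulEquiv.ofBijective (MulHom.mk Φ hmul) ⟨hinj, hsurj⟩⟩

end HomotopyGroupMap

/-! ### Perfect elimination orderings -/

namespace DetArrangement

variable {n : ℕ}

section Ordering

variable {G : SimpleGraph (Fin n)} {τ : Equiv.Perm (Fin n)}

/-- In a perfect elimination ordering, the vertices from which a decreasing path leads to a given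
vertex `a`, minimal among the non-isolated ones, are closed under adjacency. -/
theorem descends_of_adj
    (hτ : ∀ v, G.IsClique (insert v {w : Fin n | G.Adj v w ∧ τ w < τ v}))
    {a : Fin n} (ha : ∀ u w, G.Adj u w → τ a ≤ τ u) {d u : Fin n}
    (hd : Relation.ReflTransGen (fun x y => G.Adj x y ∧ τ y < τ x) d a) (hu : G.Adj u d) :
    Relation.ReflTransGen (fun x y => G.Adj x y ∧ τ y < τ x) u a := by
  induction hd using Relation.ReflTransGen.head_induction_on with
  | refl =>
    refine Relation.ReflTransGen.single ⟨hu, lt_of_le_of_ne (ha u a hu) fun h => ?_⟩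
    exact hu.ne (τ.injective h.symm)
  | head h hd ih =>
    rename_i d d'
    rcases lt_or_ge (τ d) (τ u) with hlt | hge
    · exact Relation.ReflTransGen.head ⟨hu, hlt⟩ (Relation.ReflTransGen.head h hd)
    · have hlt : τ u < τ d := lt_of_le_of_ne hge fun e => hu.ne (τ.injective e)
      by_cases hud : u = d'
      · exact hud ▸ hd
      -- Both `u` and `d'` are earlier neighbours of `d`, hence adjacent, and the path from `d'` is
      -- shorter.
      · exact ih (hτ d (Set.mem_insert_of_mem _ ⟨hu.symm, hlt⟩) (Set.mem_insert_of_mem _ h) hud)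

theorem descends_of_walk
    (hτ : ∀ v, G.IsClique (insert v {w : Fin n | G.Adj v w ∧ τ w < τ v}))
    {a : Fin n} (ha : ∀ u w, G.Adj u w → τ a ≤ τ u) {v : Fin n} (p : G.Walk v a) :
    Relation.ReflTransGen (fun x y => G.Adj x y ∧ τ y < τ x) v a := by
  induction p with
  | nil => exact Relation.ReflTransGen.refl
  | cons h _ ih => exact descends_of_adj hτ ha (ih ha) h

/-- Uniqueness of the component joins every non-isolated vertex to `a` by a walk, which can be made
decreasing; its first step is the earlier neighbour. -/
theorem exists_first_vertex
    (hτ : ∀ v, G.IsClique (insert v {w : Fin n | G.Adj v w ∧ τ w < τ v}))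
    (hc : HasUniqueNontrivialComponent G) :
    ∃ a : Fin n, (∃ u, G.Adj a u) ∧ (∀ u, G.Adj a u → τ a < τ u) ∧
      ∀ w u, G.Adj w u → w ≠ a → ∃ u', G.Adj w u' ∧ τ u' < τ w := by
  obtain ⟨c, ⟨x, hx, y, hy, hxy⟩, huniq⟩ := hc
  have hmk : ∀ {u w}, G.Adj u w → G.connectedComponentMk u = c := fun {u w} h =>
    huniq _ ⟨u, rfl, w, SimpleGraph.ConnectedComponent.sound h.symm.reachable, h.ne⟩
  have hne : ∃ u, ∃ w, G.Adj u w := by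
    obtain ⟨p⟩ := SimpleGraph.ConnectedComponent.exact (hx.trans hy.symm)
    cases p with
    | nil => exact absurd rfl hxy
    | cons h _ => exact ⟨_, _, h⟩
  obtain ⟨a, ⟨u₀, hu₀⟩, hmin⟩ := Set.exists_min_image {u | ∃ w, G.Adj u w} τ (Set.toFinite _) hne
  have hmin' : ∀ u w, G.Adj u w → τ a ≤ τ u := fun u w h => hmin u ⟨w, h⟩
  refine ⟨a, ⟨u₀, hu₀⟩, fun u hu => ?_, fun w u hwu hwa => ?_⟩
  · exact lt_of_le_of_ne (hmin' u a hu.symm) fun e => hu.ne (τ.injective e)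
  · obtain ⟨p⟩ := SimpleGraph.ConnectedComponent.exact ((hmk hwu).trans (hmk hu₀).symm)
    rcases (descends_of_walk hτ hmin' p).cases_head with h | ⟨u', h, -⟩
    · exact absurd h hwa
    · exact ⟨u', h⟩

end Ordering

theorem minor_swap (i j : Fin n) (M : Matrix (Fin 2) (Fin n) ℂ) : minor j i M = -minor i j M := by
  unfold minor; ring

theorem mem_complement_iff (G : SimpleGraph (Fin n)) (M : Matrix (Fin 2) (Fin n) ℂ) :
    M ∈ complement G ↔ ∀ i j, G.Adj i j → minor i j M ≠ 0 := by
  constructor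
  · intro h i j hij h0
    rcases lt_or_gt_of_ne hij.ne with hlt | hlt
    · exact h ⟨detVariety i j, ⟨i, j, hlt, hij, rfl⟩, h0⟩
    · exact h ⟨detVariety j i, ⟨j, i, hlt, hij.symm, rfl⟩, by
        change minor j i M = 0
        rw [minor_swap, h0, neg_zero]⟩
  · rintro h ⟨V, ⟨i, j, -, hij, rfl⟩, hM⟩
    exact h i j hij hM

/-! ### The tower of slices -/

section Tower

variable (G : SimpleGraph (Fin n)) (τ : Equiv.Perm (Fin n)) (a : Fin n)

/-- The matrices whose column `a` is a positive multiple of the first basis vector, and whose minors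
do not vanish at the edges between the first `k` vertices. -/
def slice (k : ℕ) : Set (Matrix (Fin 2) (Fin n) ℂ) :=
  {M | ((M 0 a).im = 0 ∧ 0 < (M 0 a).re ∧ M 1 a = 0) ∧
    ∀ i j, G.Adj i j → (τ i : ℕ) < k → (τ j : ℕ) < k → minor i j M ≠ 0}

/-- The matrix obtained by replacing the column `v`. -/
def setColumn (v : Fin n) (M : Matrix (Fin 2) (Fin n) ℂ) (w : ℂ × ℂ) : Matrix (Fin 2) (Fin n) ℂ :=
  Matrix.of fun i j => if j = v then ![w.1, w.2] i else M i j

theorem setColumn_self (v : Fin n) (M : Matrix (Fin 2) (Fin n) ℂ) (w : ℂ × ℂ) (i : Fin 2) :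
    setColumn v M w i v = ![w.1, w.2] i := by simp [setColumn]

theorem setColumn_of_ne {v j : Fin n} (h : j ≠ v) (M : Matrix (Fin 2) (Fin n) ℂ) (w : ℂ × ℂ)
    (i : Fin 2) : setColumn v M w i j = M i j := by simp [setColumn, h]

theorem continuous_setColumn (v : Fin n) :
    Continuous fun p : Matrix (Fin 2) (Fin n) ℂ × ℂ × ℂ => setColumn v p.1 p.2 := by
  refine continuous_matrix fun i j => ?_
  by_cases h : j = v
  · subst h
    simp only [setColumn_self]
    fin_cases i
    · exact continuous_fst.comp continuous_snd
    · exact continuous_snd.comp continuous_snd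
  · simp only [setColumn_of_ne h]
    fun_prop

theorem loopsContract_slice_zero {N : Type*} : LoopsContract N (slice G τ a 0) := by
  refine LoopsContract.of_convex ?_
  rintro M ⟨⟨h1, h2, h3⟩, -⟩ M' ⟨⟨h1', h2', h3'⟩, -⟩ s t hs ht hst
  refine ⟨⟨?_, ?_, ?_⟩, fun i j _ hi => absurd hi (Nat.not_lt_zero _)⟩
  · simp [h1, h1']
  · simp only [Matrix.add_apply, Matrix.smul_apply, Complex.add_re, Complex.real_smul,
      Complex.re_ofReal_mul]
    rcases hs.eq_or_lt with rfl | hs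
    · have : t = 1 := by linarith
      simp [this, h2']
    · have := mul_pos hs h2
      have := mul_nonneg ht h2'.le
      linarith
  · simp [h3, h3']

variable {N : Type*} [Fintype N] [Nontrivial N] [DecidableEq N]

/-- Column `v` is already present, but unconstrained by edges, in stage `k`. So stage `k + 1` is
only a retract of the bundle of new columns over stage `k`: the section records column `v` twice,
and `setColumn` overwrites the old copy. -/
theorem loopsContract_slice_succ
    (hτ : ∀ v, G.IsClique (insert v {w : Fin n | G.Adj v w ∧ τ w < τ v}))
    (ha : ∀ u, G.Adj a u → τ a < τ u)
    (hdesc : ∀ w u, G.Adj w u → w ≠ a → ∃ u', G.Adj w u' ∧ τ u' < τ w) {k : ℕ}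
    (hk : LoopsContract N (slice G τ a k)) : LoopsContract N (slice G τ a (k + 1)) := by
  classical
  by_cases hK : ∃ v w, (τ v : ℕ) = k ∧ G.Adj v w ∧ τ w < τ v
  swap
  -- An edge new at this stage would join the vertex in position `k` to an earlier one.
  · suffices h : slice G τ a (k + 1) = slice G τ a k by rw [h]; exact hk
    ext M
    refine and_congr_right fun _ => ⟨fun h i j hij hi hj => h i j hij (by lia) (by lia),
      fun h i j hij hi hj => h i j hij ?_ ?_⟩
    · by_contra hi'
      refine hK ⟨i, j, by lia, hij, Fin.lt_def.2 ?_⟩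
      have : (τ i : ℕ) ≠ τ j := fun e => hij.ne (τ.injective (Fin.ext e))
      lia
    · by_contra hj'
      refine hK ⟨j, i, by lia, hij.symm, Fin.lt_def.2 ?_⟩
      have : (τ i : ℕ) ≠ τ j := fun e => hij.ne (τ.injective (Fin.ext e))
      lia
  obtain ⟨v, w₀, hv, hw₀⟩ := hK
  have hva : a ≠ v := by
    rintro rfl
    exact lt_asymm (ha _ hw₀.1) hw₀.2
  let ι := {w : Fin n // G.Adj v w ∧ τ w < τ v}
  have hlt : ∀ w : ι, (τ w : ℕ) < k := fun w => hv ▸ Fin.lt_def.1 w.2.2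
  -- Column `a` is nonzero by normalization; any other column `w` has a nonvanishing minor with an
  -- earlier neighbour.
  have hne : ∀ (w : ι) (M : slice G τ a k), M.1 0 w ≠ 0 ∨ M.1 1 w ≠ 0 := by
    intro w M
    by_cases hwa : (w : Fin n) = a
    · left
      rw [hwa]
      intro h
      have := M.2.1.2.1
      simp [h] at this
    · obtain ⟨u, hu, hlt'⟩ := hdesc w v w.2.1.symm hwa
      have := M.2.2 w u hu (hlt w) ((Fin.lt_def.1 hlt').trans (hlt w))
      by_contra! h
      exact this (by simp [minor, h.1, h.2])
  have hlines := hk.complement_lines (fun (w : ι) M => M.1 0 w) (fun (w : ι) M => M.1 1 w)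
    (fun w => continuous_subtype_val.matrix_elem 0 _)
    (fun w => continuous_subtype_val.matrix_elem 1 _) ⟨w₀, hw₀⟩ (hne _) (by
      intro i j hij M
      refine M.2.2 i j (hτ v (Set.mem_insert_of_mem _ i.2) (Set.mem_insert_of_mem _ j.2) ?_)
        (hlt i) (hlt j)
      exact fun e => hij (Subtype.ext e))
  refine hlines.of_retract
    ⟨fun M => ⟨(⟨M.1, M.2.1, fun i j hij hi hj => M.2.2 i j hij (by lia) (by lia)⟩,
      M.1 0 v, M.1 1 v), fun w => ?_⟩, ?_⟩
    ⟨fun p => ⟨setColumn v p.1.1.1 p.1.2, ?_, ?_⟩, ?_⟩ ?_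
  · exact M.2.2 w v w.2.1.symm ((hlt w).trans (Nat.lt_succ_self k)) (by lia)
  · exact Continuous.subtype_mk ((Continuous.subtype_mk continuous_subtype_val _).prodMk
      ((continuous_subtype_val.matrix_elem 0 v).prodMk
        (continuous_subtype_val.matrix_elem 1 v))) _
  · simp only [setColumn_of_ne hva]
    exact p.1.1.2.1
  · have key : ∀ j, G.Adj v j → (τ j : ℕ) < k + 1 →
        minor j v (setColumn v p.1.1.1 p.1.2) ≠ 0 := by
      intro j hij hj
      have hjv : (τ j : ℕ) ≠ τ v := fun e => hij.ne' (τ.injective (Fin.ext e))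
      have := p.2 ⟨j, hij, Fin.lt_def.2 (by lia)⟩
      simpa [minor, setColumn_self, setColumn_of_ne hij.ne'] using this
    intro i j hij hi hj
    by_cases hiv : i = v
    · subst hiv
      rw [minor_swap]
      exact neg_ne_zero.2 (key j hij hj)
    · by_cases hjv : j = v
      · subst hjv
        exact key i hij.symm hi
      · have h1 : (τ i : ℕ) ≠ τ v := fun e => hiv (τ.injective (Fin.ext e))
        have h2 : (τ j : ℕ) ≠ τ v := fun e => hjv (τ.injective (Fin.ext e))
        have := p.1.1.2.2 i j hij (by lia) (by lia)
        simpa [minor, setColumn_of_ne hiv, setColumn_of_ne hjv] using this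
  · refine Continuous.subtype_mk ((continuous_setColumn v).comp
      (f := fun p : {p : slice G τ a k × ℂ × ℂ | ∀ i : ι, p.1.1 0 i * p.2.2 - p.2.1 * p.1.1 1 i ≠ 0}
        => (p.1.1.1, p.1.2)) (by fun_prop)) _
  · intro M
    refine Subtype.ext (Matrix.ext fun i j => ?_)
    change setColumn v M.1 (M.1 0 v, M.1 1 v) i j = M.1 i j
    by_cases hj : j = v
    · subst hj
      rw [setColumn_self]
      fin_cases i <;> rfl
    · rw [setColumn_of_ne hj]

theorem loopsContract_slice
    (hτ : ∀ v, G.IsClique (insert v {w : Fin n | G.Adj v w ∧ τ w < τ v}))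
    (ha : ∀ u, G.Adj a u → τ a < τ u)
    (hdesc : ∀ w u, G.Adj w u → w ≠ a → ∃ u', G.Adj w u' ∧ τ u' < τ w) (k : ℕ) :
    LoopsContract N (slice G τ a k) := by
  induction k with
  | zero => exact loopsContract_slice_zero G τ a
  | succ k ih => exact loopsContract_slice_succ G τ a hτ ha hdesc ih

end Tower

end DetArrangement

/-! ### Splitting off the three-sphere -/

namespace DetArrangement

open ComplexConjugate

section Sphere

/-- The identification of `ℂ²` with `ℝ⁴`. -/
noncomputable def realVec (w : ℂ × ℂ) : EuclideanSpace ℝ (Fin 4) :=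
  !₂[w.1.re, w.1.im, w.2.re, w.2.im]

/-- The identification of `ℝ⁴` with `ℂ²`. -/
def complexVec (s : EuclideanSpace ℝ (Fin 4)) : ℂ × ℂ := (⟨s 0, s 1⟩, ⟨s 2, s 3⟩)

theorem continuous_realVec : Continuous realVec := by
  refine (PiLp.continuous_toLp 2 _).comp (continuous_pi fun i => ?_)
  fin_cases i
  · exact Complex.continuous_re.comp continuous_fst
  · exact Complex.continuous_im.comp continuous_fst
  · exact Complex.continuous_re.comp continuous_snd
  · exact Complex.continuous_im.comp continuous_snd

theorem continuous_complexVec : Continuous complexVec :=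
  (continuous_complex_mk (by fun_prop) (by fun_prop)).prodMk
    (continuous_complex_mk (by fun_prop) (by fun_prop))

theorem realVec_complexVec (s : EuclideanSpace ℝ (Fin 4)) : realVec (complexVec s) = s := by
  ext i; fin_cases i <;> rfl

theorem complexVec_realVec (w : ℂ × ℂ) : complexVec (realVec w) = w := rfl

theorem complexVec_smul (r : ℝ) (s : EuclideanSpace ℝ (Fin 4)) :
    complexVec (r • s) = ((r : ℂ) * (complexVec s).1, (r : ℂ) * (complexVec s).2) := by
  refine Prod.ext ?_ ?_ <;> apply Complex.ext <;> simp [complexVec]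

theorem complexVec_mul_conj (s : EuclideanSpace ℝ (Fin 4)) :
    (complexVec s).1 * conj (complexVec s).1 + (complexVec s).2 * conj (complexVec s).2 =
      ((‖s‖ ^ 2 : ℝ) : ℂ) := by
  rw [Complex.mul_conj, Complex.mul_conj, ← Complex.ofReal_add, EuclideanSpace.norm_sq_eq]
  congr 1
  simp [complexVec, Complex.normSq_apply, Fin.sum_univ_four]
  ring

theorem realVec_ne_zero {w : ℂ × ℂ} (h : w ≠ 0) : realVec w ≠ 0 := fun h0 => h (by
  rw [← complexVec_realVec w, h0]
  rfl)

/-- A rotation or reflection of the sphere carrying a given point to another one. -/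
theorem exists_sphere_homeomorph {E : Type*} [NormedAddCommGroup E] [InnerProductSpace ℝ E]
    (s t : Metric.sphere (0 : E) 1) :
    ∃ h : Metric.sphere (0 : E) 1 ≃ₜ Metric.sphere (0 : E) 1, h s = t := by
  let A : E ≃ₗᵢ[ℝ] E := (Submodule.span ℝ {(s : E) - t})ᗮ.reflection
  have hA : ∀ x : Metric.sphere (0 : E) 1, A x ∈ Metric.sphere (0 : E) 1 := fun x => by simp
  have hA' : ∀ x : Metric.sphere (0 : E) 1, A.symm x ∈ Metric.sphere (0 : E) 1 := fun x => by simp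
  refine ⟨⟨⟨fun x => ⟨A x, hA x⟩, fun x => ⟨A.symm x, hA' x⟩, fun x => by simp, fun x => by simp⟩,
    by fun_prop, by fun_prop⟩, Subtype.ext ?_⟩
  exact Submodule.reflection_sub (by simp)

end Sphere

variable {n : ℕ}

/-- Left multiplication by the matrix with rows `(p, q)` and `(r, s)`. -/
def rowOp (p q r s : ℂ) (M : Matrix (Fin 2) (Fin n) ℂ) : Matrix (Fin 2) (Fin n) ℂ :=
  Matrix.of ![fun j => p * M 0 j + q * M 1 j, fun j => r * M 0 j + s * M 1 j]

theorem rowOp_zero (p q r s : ℂ) (M : Matrix (Fin 2) (Fin n) ℂ) (j : Fin n) :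
    rowOp p q r s M 0 j = p * M 0 j + q * M 1 j := rfl

theorem rowOp_one (p q r s : ℂ) (M : Matrix (Fin 2) (Fin n) ℂ) (j : Fin n) :
    rowOp p q r s M 1 j = r * M 0 j + s * M 1 j := rfl

theorem minor_rowOp (p q r s : ℂ) (M : Matrix (Fin 2) (Fin n) ℂ) (i j : Fin n) :
    minor i j (rowOp p q r s M) = (p * s - q * r) * minor i j M := by
  simp only [minor, rowOp_zero, rowOp_one]; ring

theorem continuous_rowOp {Z : Type*} [TopologicalSpace Z] {p q r s : Z → ℂ}
    {M : Z → Matrix (Fin 2) (Fin n) ℂ} (hp : Continuous p) (hq : Continuous q) (hr : Continuous r)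
    (hs : Continuous s) (hM : Continuous M) :
    Continuous fun z => rowOp (p z) (q z) (r z) (s z) (M z) := by
  refine continuous_matrix fun i j => ?_
  have h0 := hM.matrix_elem 0 j
  have h1 := hM.matrix_elem 1 j
  fin_cases i
  · exact (hp.mul h0).add (hq.mul h1)
  · exact (hr.mul h0).add (hs.mul h1)

/-- The complement of the arrangement of `G` splits as the product of the three-sphere and a space
without higher homotopy groups. -/
theorem exists_sphere_splitting (G : SimpleGraph (Fin n)) (τ : Equiv.Perm (Fin n)) (a : Fin n)
    (ha : ∃ u, G.Adj a u) :
    ∃ (φ : C(complement G, Metric.sphere (0 : EuclideanSpace ℝ (Fin 4)) 1))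
      (η : C(complement G, slice G τ a n))
      (ψ : C(Metric.sphere (0 : EuclideanSpace ℝ (Fin 4)) 1 × slice G τ a n, complement G)),
      (∀ x, ψ (φ x, η x) = x) ∧ ∀ p, φ (ψ p) = p.1 := by
  obtain ⟨u, hu⟩ := ha
  let col : Matrix (Fin 2) (Fin n) ℂ → ℂ × ℂ := fun M => (M 0 a, M 1 a)
  have hcol : Continuous fun M : complement G => col M :=
    (continuous_subtype_val.matrix_elem 0 a).prodMk (continuous_subtype_val.matrix_elem 1 a)
  have hcol0 : ∀ M : complement G, realVec (col M) ≠ 0 := by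
    intro M
    refine realVec_ne_zero fun h => (mem_complement_iff G _).1 M.2 a u hu ?_
    have h1 : M.1 0 a = 0 := congrArg Prod.fst h
    have h2 : M.1 1 a = 0 := congrArg Prod.snd h
    simp [minor, h1, h2]
  have hr : Continuous fun M : complement G => realVec (col M) := continuous_realVec.comp hcol
  have hnr : Continuous fun M : complement G => ‖realVec (col M)‖⁻¹ • realVec (col M) :=
    (hr.norm.inv₀ fun M => norm_ne_zero_iff.2 (hcol0 M)).smul hr
  have hmem : ∀ M : complement G, ‖realVec (col M)‖⁻¹ • realVec (col M) ∈
      Metric.sphere (0 : EuclideanSpace ℝ (Fin 4)) 1 := fun M => by simp [norm_smul, hcol0 M]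
  let φ : C(complement G, Metric.sphere (0 : EuclideanSpace ℝ (Fin 4)) 1) :=
    ⟨fun M => ⟨‖realVec (col M)‖⁻¹ • realVec (col M), hmem M⟩, hnr.subtype_mk hmem⟩
  let v : Metric.sphere (0 : EuclideanSpace ℝ (Fin 4)) 1 → ℂ × ℂ := fun s => complexVec s
  have hv : Continuous v := continuous_complexVec.comp continuous_subtype_val
  have hv1 : ∀ s, (v s).1 * conj (v s).1 + (v s).2 * conj (v s).2 = 1 := fun s => by
    rw [complexVec_mul_conj, norm_eq_of_mem_sphere]; simp
  have hφcol : ∀ M : complement G, (M.1 0 a = ‖realVec (col M)‖ * (v (φ M)).1) ∧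
      M.1 1 a = ‖realVec (col M)‖ * (v (φ M)).2 := by
    intro M
    have h : v (φ M) = _ := complexVec_smul ‖realVec (col M)‖⁻¹ (realVec (col M))
    have h0 : (‖realVec (col M)‖ : ℂ) ≠ 0 := by simpa using hcol0 M
    rw [h, complexVec_realVec]
    constructor <;> simp [mul_inv_cancel_left₀ h0, col]
  -- `fwd s` multiplies by the matrix of SU(2) with first column `v s`, and `inv s` by its conjugate
  -- transpose.
  let inv : Metric.sphere (0 : EuclideanSpace ℝ (Fin 4)) 1 → Matrix (Fin 2) (Fin n) ℂ →
      Matrix (Fin 2) (Fin n) ℂ := fun s M => rowOp (conj (v s).1) (conj (v s).2) (-(v s).2) (v s).1 M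
  let fwd : Metric.sphere (0 : EuclideanSpace ℝ (Fin 4)) 1 → Matrix (Fin 2) (Fin n) ℂ →
      Matrix (Fin 2) (Fin n) ℂ := fun s M => rowOp (v s).1 (-conj (v s).2) (v s).2 (conj (v s).1) M
  have hinv : ∀ s M i j, minor i j (inv s M) = minor i j M := by
    intro s M i j
    rw [minor_rowOp]
    linear_combination minor i j M * hv1 s
  have hfwd : ∀ s M i j, minor i j (fwd s M) = minor i j M := by
    intro s M i j
    rw [minor_rowOp]
    linear_combination minor i j M * hv1 s
  have hfi : ∀ s M, fwd s (inv s M) = M := by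
    intro s M
    refine Matrix.ext fun i j => ?_
    fin_cases i
    · change fwd s (inv s M) 0 j = M 0 j
      simp only [fwd, inv, rowOp_zero, rowOp_one]
      linear_combination M 0 j * hv1 s
    · change fwd s (inv s M) 1 j = M 1 j
      simp only [fwd, inv, rowOp_zero, rowOp_one]
      linear_combination M 1 j * hv1 s
  have hinvcol : ∀ M : complement G, inv (φ M) M 0 a = ‖realVec (col M)‖ ∧ inv (φ M) M 1 a = 0 := by
    intro M
    obtain ⟨h0, h1⟩ := hφcol M
    simp only [inv, rowOp_zero, rowOp_one]
    constructor
    · rw [h0, h1]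
      linear_combination (‖realVec (col M)‖ : ℂ) * hv1 (φ M)
    · rw [h0, h1]
      ring
  have hinvc : Continuous fun M : complement G => inv (φ M) M := by
    have h : Continuous fun M => v (φ M) := hv.comp φ.continuous
    exact continuous_rowOp (p := fun M => conj (v (φ M)).1) (q := fun M => conj (v (φ M)).2)
      (r := fun M => -(v (φ M)).2) (s := fun M => (v (φ M)).1) (M := fun M => M.1)
      (by fun_prop) (by fun_prop) (by fun_prop) (by fun_prop) continuous_subtype_val
  have hfwdc : Continuous fun p : Metric.sphere (0 : EuclideanSpace ℝ (Fin 4)) 1 × slice G τ a n =>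
      fwd p.1 p.2 := by
    have h : Continuous fun p : Metric.sphere (0 : EuclideanSpace ℝ (Fin 4)) 1 × slice G τ a n =>
      v p.1 := hv.comp continuous_fst
    exact continuous_rowOp
      (p := fun p : Metric.sphere (0 : EuclideanSpace ℝ (Fin 4)) 1 × slice G τ a n => (v p.1).1)
      (q := fun p => -conj (v p.1).2) (r := fun p => (v p.1).2) (s := fun p => conj (v p.1).1)
      (M := fun p => p.2.1) (by fun_prop) (by fun_prop) (by fun_prop) (by fun_prop)
      (continuous_subtype_val.comp continuous_snd)
  have hinvmem : ∀ M : complement G, inv (φ M) M ∈ slice G τ a n := fun M => by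
    obtain ⟨h0, h1⟩ := hinvcol M
    refine ⟨?_, fun i j hij _ _ => ?_⟩
    · rw [h0, h1]
      exact ⟨Complex.ofReal_im _, by simpa using hcol0 M, rfl⟩
    · rw [hinv]
      exact (mem_complement_iff G _).1 M.2 i j hij
  have hfwdmem : ∀ p : Metric.sphere (0 : EuclideanSpace ℝ (Fin 4)) 1 × slice G τ a n,
      fwd p.1 p.2 ∈ complement G := fun p => (mem_complement_iff G _).2 fun i j hij => by
    rw [hfwd]
    exact p.2.2.2 i j hij (τ i).2 (τ j).2
  let η : C(complement G, slice G τ a n) :=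
    ⟨fun M => ⟨inv (φ M) M, hinvmem M⟩, hinvc.subtype_mk hinvmem⟩
  let ψ : C(Metric.sphere (0 : EuclideanSpace ℝ (Fin 4)) 1 × slice G τ a n, complement G) :=
    ⟨fun p => ⟨fwd p.1 p.2, hfwdmem p⟩, hfwdc.subtype_mk hfwdmem⟩
  refine ⟨φ, η, ψ, fun M => Subtype.ext (hfi _ _), fun p => Subtype.ext ?_⟩
  obtain ⟨him, hre, h1⟩ := p.2.2.1
  have h0 : p.2.1 0 a = ((p.2.1 0 a).re : ℂ) := Complex.ext rfl him
  have hc : col (fwd p.1 p.2) = complexVec ((p.2.1 0 a).re • p.1.1) := by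
    rw [complexVec_smul]
    refine Prod.ext ?_ ?_
    · change fwd p.1 p.2 0 a = _
      simp only [fwd, rowOp_zero, h1]
      rw [← h0]
      ring
    · change fwd p.1 p.2 1 a = _
      simp only [fwd, rowOp_one, h1]
      rw [← h0]
      ring
  change ‖realVec (col (fwd p.1 p.2))‖⁻¹ • realVec (col (fwd p.1 p.2)) = p.1.1
  rw [hc, realVec_complexVec, norm_smul, norm_eq_of_mem_sphere, mul_one, Real.norm_of_nonneg hre.le,
    inv_smul_smul₀ hre.ne']

end DetArrangement

theorem theorem4p3 {n : ℕ} (G : SimpleGraph (Fin n))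
    (hG : DetArrangement.IsChordal G)
    (hc : DetArrangement.HasUniqueNontrivialComponent G)
    (u : DetArrangement.complement G)
    (s : Metric.sphere (0 : EuclideanSpace ℝ (Fin 4)) 1)
    (i : ℕ) :
    Nonempty (π_ (i + 2) (DetArrangement.complement G) u ≃*
      π_ (i + 2) (Metric.sphere (0 : EuclideanSpace ℝ (Fin 4)) 1) s) := by
  obtain ⟨τ, hτ⟩ := hG
  obtain ⟨a, ha, hfirst, hdesc⟩ := DetArrangement.exists_first_vertex hτ hc
  obtain ⟨φ, η, ψ, hψ, hφ⟩ := DetArrangement.exists_sphere_splitting G τ a ha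
  -- The splitting dictates the base point `φ u` on the sphere; `h` moves it to `s`.
  obtain ⟨h, hh⟩ := DetArrangement.exists_sphere_homeomorph (φ u) s
  exact nonempty_homotopyGroup_mulEquiv_of_prod ⟨fun x => h (φ x), by fun_prop⟩ η
    ⟨fun p => ψ (h.symm p.1, p.2), by fun_prop⟩ (fun x => by simp [hψ]) (fun p => by simp [hφ])
    (DetArrangement.loopsContract_slice G τ a hτ hfirst hdesc n) u hh
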